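/- Let $\mathcal G$ be a digraph without self-loops on $\{1,\dots,N\}$ that contains a directed spanning tree, let $\mathcal N_i$ be the set of nodes with an edge to $i$, and let $L=D-\mathcal A$ be its Laplacian ($D$ the diagonal matrix of in-degrees, $a_{ij}=1$ if there is an edge from $j$ to $i$ and $a_{ij}=0$ otherwise). Consider $N$ agents $\dot x_i=Ax_i+Bu_i$, $y_i=Cx_i$, $x_i(t)\in\mathbb R^n$, with observers and controls $$\dot{\hat x}_i=A\hat x_i+Bu_i+cF\sum_{j\in\mathcal N_i}\big((y_j-y_i)+C(\hat x_i-\hat x_j)\big),\qquad u_i=cK\sum_{j\in\mathcal N_i}(\hat x_i-\hat x_j),$$ free of attacks, and assume that they are designed so that this closed loop reaches consensus: for every initial condition, $\|y_i(t)-y_j(t)\|\to0$ and $\|\hat x_i(t)-\hat x_j(t)\|\to0$ as $t\to\infty$ for all $i,j$. Let $A_z$ be a diagonal Hurwitz matrix, $B_z,F_z\in\mathbb R^{n\times n}$, $c_z>0$ and $\alpha>0$, and consider the event-triggered detectors, free of attacks, $$\dot z_i(t)=A_zz_i(t)+B_z\hat x_i(t)+F_z\sum_{j\in\mathcal N_i}\Big(e^{A_z(t-t^j_{k_j})}z_j(t^j_{k_j})-e^{A_z(t-t^i_{k_i})}z_i(t^i_{k_i})\Big),$$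 where $t^i_{k_i}$ is the most recent event time of agent $i$ at time $t$, $t^i_0=0$, and the event $t^i_{k+1}$ of agent $i$ is the first time $t>t^i_k$ with $\|e_i(t)\|\ge c_ze^{-\alpha t}$, where $e_i(t)=e^{A_z(t-t^i_k)}z_i(t^i_k)-z_i(t)$ (there is no such event if this never happens). A solution is a priori required only up to the first time at which the events of some agent accumulate. Then: 1. For every initial condition $(x(0),\hat x(0),z(0))$ a solution exists. 2. The detectors reach a consensus, i.e. $\|z_i(t)-z_j(t)\|\to0$ as $t\to\infty$ for all $i,j$ and all initial conditions, if and only if $A_z-\lambda F_z$ is Hurwitz for every nonzero eigenvalue $\lambda\in\mathbb C$ of $L$. 3. There is no Zeno behaviour: in every solution each agent has only finitely many events in every bounded time interval. So every solution is defined for all $t\ge0$, and for every solution and every $T$ there is $\tau>0$ such that every event at a time $\le T$ is followed by the next event of the same agent, if there is one, at least $\tau$ later. In particular this holds for $0<\alpha<-\max\operatorname{Re}\lambda(\tilde A_z)$, where the eigenvalues of $\tilde A_z$ are those of the matrices $A_z-\lambda F_z$, with $\lambda$ running through the nonzero eigenvalues of $L$. -/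

import Mathlib

open Filter Topology

noncomputable section

/-! ### Digraphs -/

/-- `T` is a directed tree rooted at `r` that spans all vertices (an edge `T.Adj i j` goes from `i`
to `j`): the root has no incoming edge, every other vertex has exactly one incoming edge, and every
vertex is reached from the root along a directed path. -/
structure IsDirectedSpanningTree {V : Type*} (T : Digraph V) (r : V) : Prop where
  root_no_parent : ∀ j, ¬ T.Adj j r
  unique_parent : ∀ i, i ≠ r → ∃! j, T.Adj j i
  reachable : ∀ i, Relation.ReflTransGen T.Adj r i

/-- The digraph `G` contains at least one directed spanning tree. -/
def ContainsSpanningTree {V : Type*} (G : Digraph V) : Prop :=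
  ∃ (T : Digraph V) (r : V), (∀ i j, T.Adj i j → G.Adj i j) ∧ IsDirectedSpanningTree T r

/-- The set `𝒩ᵢ` of neighbours of node `i`: the nodes that have an edge to `i`. -/
def inNeighbors {N : ℕ} (G : Digraph (Fin N)) [DecidableRel G.Adj] (i : Fin N) : Finset (Fin N) :=
  Finset.univ.filter fun j => G.Adj j i

/-- The adjacency matrix, `a_ij = 1` if there is a link from node `j` to node `i`. -/
def adjacencyMatrix {N : ℕ} (G : Digraph (Fin N)) [DecidableRel G.Adj] :
    Matrix (Fin N) (Fin N) ℝ :=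
  Matrix.of fun i j => if G.Adj j i then 1 else 0

/-- The Laplacian matrix `L = D - 𝒜`, with `D` the diagonal matrix of in-degrees. -/
def laplacian {N : ℕ} (G : Digraph (Fin N)) [DecidableRel G.Adj] : Matrix (Fin N) (Fin N) ℝ :=
  Matrix.diagonal (fun i => ((inNeighbors G i).card : ℝ)) - adjacencyMatrix G

/-! ### Matrices and vectors -/

/-- A real matrix, viewed as a complex one. -/
def toComplex {k l : ℕ} (M : Matrix (Fin k) (Fin l) ℝ) : Matrix (Fin k) (Fin l) ℂ :=
  M.map Complex.ofReal

/-- A square matrix is Hurwitz if all its eigenvalues have negative real part. -/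
def IsHurwitz {n : ℕ} (M : Matrix (Fin n) (Fin n) ℂ) : Prop :=
  ∀ μ ∈ spectrum ℂ M, μ.re < 0

/-- The Euclidean norm of a vector. -/
def euclNorm {n : ℕ} (v : Fin n → ℝ) : ℝ := ‖(WithLp.toLp 2 v : EuclideanSpace ℝ (Fin n))‖

/-! ### The multi-agent system and its observers, free of attacks -/

/-- The matrices of the agents `ẋᵢ = A xᵢ + B uᵢ`, `yᵢ = C xᵢ` and the gains of the observer-based
consensus protocol. -/
structure MASParams (n m p : ℕ) where
  A : Matrix (Fin n) (Fin n) ℝ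
  B : Matrix (Fin n) (Fin m) ℝ
  C : Matrix (Fin p) (Fin n) ℝ
  K : Matrix (Fin m) (Fin n) ℝ
  F : Matrix (Fin n) (Fin p) ℝ
  c : ℝ

variable {N n m p : ℕ}

/-- The control input `uᵢ = c K ∑_{j ∈ 𝒩ᵢ} (x̂ᵢ - x̂ⱼ)`; here `xh i` is the observer state of
agent `i`. -/
def controlInput (G : Digraph (Fin N)) [DecidableRel G.Adj] (S : MASParams n m p)
    (xh : Fin N → Fin n → ℝ) (i : Fin N) : Fin m → ℝ :=
  S.c • S.K.mulVec (∑ j ∈ inNeighbors G i, (xh i - xh j))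

/-- The observer innovation `ζᵢ = ∑_{j ∈ 𝒩ᵢ} ((yⱼ - yᵢ) + C (x̂ᵢ - x̂ⱼ))`, where `yᵢ = C xᵢ`. -/
def innovation (G : Digraph (Fin N)) [DecidableRel G.Adj] (S : MASParams n m p)
    (x xh : Fin N → Fin n → ℝ) (i : Fin N) : Fin p → ℝ :=
  ∑ j ∈ inNeighbors G i, ((S.C.mulVec (x j) - S.C.mulVec (x i)) + S.C.mulVec (xh i - xh j))

/-- `(x, x̂)` solves the closed loop of agents and observers on `[0, ∞)`:
`ẋᵢ = A xᵢ + B uᵢ` and `d/dt x̂ᵢ = A x̂ᵢ + B uᵢ + c F ζᵢ`.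
(The other sign convention of the observer gain is obtained by replacing `F` by `-F`.) -/
structure IsMASSolution (G : Digraph (Fin N)) [DecidableRel G.Adj] (S : MASParams n m p)
    (x xh : ℝ → Fin N → Fin n → ℝ) : Prop where
  agent : ∀ t : ℝ, 0 ≤ t → ∀ i, HasDerivWithinAt (fun s => x s i)
    (S.A.mulVec (x t i) + S.B.mulVec (controlInput G S (xh t) i)) (Set.Ici 0) t
  observer : ∀ t : ℝ, 0 ≤ t → ∀ i, HasDerivWithinAt (fun s => xh s i)
    (S.A.mulVec (xh t i) + S.B.mulVec (controlInput G S (xh t) i)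
      + S.c • S.F.mulVec (innovation G S (x t) (xh t) i)) (Set.Ici 0) t

/-- Consensus of the multi-agent system: for any initial condition, all differences
`yᵢ - yⱼ` and `x̂ᵢ - x̂ⱼ` tend to zero. -/
def MASReachesConsensus (G : Digraph (Fin N)) [DecidableRel G.Adj] (S : MASParams n m p) : Prop :=
  ∀ x xh : ℝ → Fin N → Fin n → ℝ, IsMASSolution G S x xh → ∀ i j,
    Tendsto (fun t => euclNorm (S.C.mulVec (x t i) - S.C.mulVec (x t j))) atTop (𝓝 0) ∧
    Tendsto (fun t => euclNorm (xh t i - xh t j)) atTop (𝓝 0)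

/-! ### The event-triggered detectors, free of attacks -/

/-- The matrices of the detectors and the constants of the triggering threshold
`c_z exp (-α t)`. -/
structure DetectorParams (n : ℕ) where
  Az : Matrix (Fin n) (Fin n) ℝ
  Bz : Matrix (Fin n) (Fin n) ℝ
  Fz : Matrix (Fin n) (Fin n) ℝ
  cz : ℝ
  α : ℝ

/-- `exp (A_z (t - s)) v`: the value at time `t` that all agents predict from the state `v`
broadcast at time `s`. -/
def predicted (D : DetectorParams n) (s : ℝ) (v : Fin n → ℝ) (t : ℝ) : Fin n → ℝ :=
  (NormedSpace.exp ((t - s) • D.Az)).mulVec v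

/-- Event times: `tk i k` is the time of the `k`-th event of agent `i`, and `⊤` if agent `i` has no
`k`-th event. The lifespan is the first accumulation time of the events of an agent; it
is `⊤` if the events of no agent accumulate. -/
def lifespan (tk : Fin N → ℕ → EReal) : EReal := ⨅ i, ⨆ k, tk i k

/-- The state error `eᵢ(t) = exp (A_z (t - tᵢₖ)) zᵢ(tᵢₖ) - zᵢ(t)` of agent `i` at time `t`, relative
to its `k`-th event. -/
def stateError (D : DetectorParams n) (tk : Fin N → ℕ → EReal) (z : ℝ → Fin N → Fin n → ℝ)
    (i : Fin N) (k : ℕ) (t : ℝ) : Fin n → ℝ :=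
  predicted D (tk i k).toReal (z (tk i k).toReal i) t - z t i

/-- `(x, x̂, z)` with event times `tk` is an execution of the event-triggered detectors. Nothing
excludes accumulation of events beforehand: the detector equations are imposed only before the
first accumulation time `lifespan tk`.

* `(x, x̂)` is a solution of the multi-agent system and its observers.
* Every agent broadcasts at time `0`, and its next event is the first later time at which
  `‖eᵢ(t)‖ ≥ c_z exp (-α t)` (the infimum of the empty set is `⊤`: no further event).
* `z` is continuous, and if `κ j` is the index of the most recent event of each agent `j` at time
  `t`, then at time `t`
  `żᵢ = A_z zᵢ + B_z x̂ᵢ + F_z ∑_{j ∈ 𝒩ᵢ} (exp (A_z (t - tⱼ)) zⱼ(tⱼ) - exp (A_z (t - tᵢ)) zᵢ(tᵢ))`,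
  where `tⱼ` is the time of that event. The right-hand side may jump at events, so the derivative is
  the right one. -/
structure IsExecution (G : Digraph (Fin N)) [DecidableRel G.Adj] (S : MASParams n m p)
    (D : DetectorParams n) (x xh : ℝ → Fin N → Fin n → ℝ) (tk : Fin N → ℕ → EReal)
    (z : ℝ → Fin N → Fin n → ℝ) : Prop where
  mas : IsMASSolution G S x xh
  first_event : ∀ i, tk i 0 = 0
  next_event : ∀ i k, tk i (k + 1) = sInf {s : EReal | ∃ t : ℝ, s = (t : EReal) ∧
    tk i k < (t : EReal) ∧ (t : EReal) < lifespan tk ∧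
    D.cz * Real.exp (-D.α * t) ≤ euclNorm (stateError D tk z i k t)}
  continuous : ∀ i, ContinuousOn (fun t => z t i) {t : ℝ | 0 ≤ t ∧ (t : EReal) < lifespan tk}
  detector : ∀ t : ℝ, 0 ≤ t → (t : EReal) < lifespan tk → ∀ κ : Fin N → ℕ,
    (∀ j, tk j (κ j) ≤ (t : EReal) ∧ (t : EReal) < tk j (κ j + 1)) →
    ∀ i, HasDerivWithinAt (fun s => z s i)
      (D.Az.mulVec (z t i) + D.Bz.mulVec (xh t i) +
        D.Fz.mulVec (∑ j ∈ inNeighbors G i,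
          (predicted D (tk j (κ j)).toReal (z (tk j (κ j)).toReal j) t -
            predicted D (tk i (κ i)).toReal (z (tk i (κ i)).toReal i) t)))
      (Set.Ici t) t

/-- The detectors reach a consensus: for any initial condition, all differences `zᵢ - zⱼ` tend to
zero. -/
def DetectorsReachConsensus (G : Digraph (Fin N)) [DecidableRel G.Adj] (S : MASParams n m p)
    (D : DetectorParams n) : Prop :=
  ∀ (x xh : ℝ → Fin N → Fin n → ℝ) (tk : Fin N → ℕ → EReal) (z : ℝ → Fin N → Fin n → ℝ),
    IsExecution G S D x xh tk z → ∀ i j,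
      Tendsto (fun t => euclNorm (z t i - z t j)) atTop (𝓝 0)

/-- No Zeno behaviour: every agent has only finitely many events in bounded time. -/
def NoZeno (tk : Fin N → ℕ → EReal) : Prop :=
  ∀ (i : Fin N) (T : ℝ), {k : ℕ | tk i k ≤ (T : EReal)}.Finite

end

/-!
The prediction errors `eⱼ = pⱼ - zⱼ`, where `pⱼ` is the state that the agents predict for agent `j`,
stay below the threshold `c_z exp (-α t)`, so the detectors obey the linear equation
`ż = (I ⊗ A_z - L ⊗ F_z) z + (I ⊗ B_z) x̂ - (L ⊗ F_z) e` with an exponentially small `e`. All parts of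
the theorem rest on this (`IsExecution.exists_prediction`, `detectorField_eq_drift_add`).

*No Zeno behaviour.* On a bounded interval without accumulation of events, Grönwall's inequality
bounds `z` and `ż`. A state error vanishes at its event, grows at a bounded rate and has to reach a
threshold that is bounded below, so consecutive events have a positive distance
(`IsExecution.exists_gap`). If the lifespan were finite, this would apply up to the lifespan and
contradict the accumulation of events there (`IsExecution.lifespan_eq_top`).

*Existence.* As long as the broadcast values are kept, the equations are linear with a continuous
input. Steps lead to the next event of some agent, or take unit time if no event comes before
(`RunState.exists_step`). The time of the `l`-th step plus the number of events so far is at least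
`l`, so if the steps accumulate at a finite time, then so do the events of some agent, and the
lifespan is the supremum of the times of the steps (`IsRun.lifespan_eq`).

*Consensus.* The eigenvalues of `I ⊗ A_z - L ⊗ F_z` are those of the matrices `A_z - λ F_z`, with
`λ` an eigenvalue of `L`; for `λ = 0` this is the Hurwitz matrix `A_z`. If the criterion holds, the
whole operator is therefore stable. Subtracting from every `zᵢ` the same solution `s` of
`ṡ = A_z s + B_z x̂ᵣ` leaves an equation whose input tends to zero, since the observers reach
consensus, so all `zᵢ - s` tend to zero (`tendsto_zero_of_drift`,
`detectorsReachConsensus_of_isHurwitz`). Conversely, let `Re μ ≥ 0` for an eigenvalue `μ` of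
`A_z - λ F_z` with `λ ≠ 0`. The tensor product of left eigenvectors of `L` and `A_z - λ F_z` is a
functional that vanishes on consensus states and obeys `ẏ = μ y + O(exp (-α t))` along executions
with `x = x̂ = 0`. It stays away from zero if it is large at time `0`
(`isHurwitz_of_detectorsReachConsensus`).
-/

/-! ### Scalar and linear differential equations with right derivatives -/

/-- Multiplication by `e^{-μ t}` removes the homogeneous part of `ẏ = μ y + g`. -/
theorem hasDerivWithinAt_cexp_neg_mul {y : ℝ → ℂ} {μ g : ℂ} {t : ℝ}
    (hy : HasDerivWithinAt y (μ * y t + g) (Set.Ici t) t) :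
    HasDerivWithinAt (fun s : ℝ => Complex.exp (-μ * s) * y s) (Complex.exp (-μ * t) * g)
      (Set.Ici t) t := by
  have h1 : HasDerivAt (fun s : ℝ => Complex.exp (-μ * s)) (Complex.exp (-μ * t) * (-μ * 1)) t :=
    ((hasDerivAt_id t).ofReal_comp.const_mul (-μ)).cexp
  refine (h1.hasDerivWithinAt.mul hy).congr_deriv ?_
  simp only [mul_one]
  ring

theorem norm_cexp_neg_mul (μ : ℂ) (t : ℝ) : ‖Complex.exp (-μ * t)‖ = Real.exp (-μ.re * t) := by
  rw [Complex.norm_exp]; simp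

/-- A stable scalar linear equation with vanishing input has vanishing solutions. The input need not
be continuous. -/
theorem tendsto_zero_of_hasDerivWithinAt {y g : ℝ → ℂ} {μ : ℂ} (hμ : μ.re < 0)
    (hc : ContinuousOn y (Set.Ici 0))
    (hy : ∀ t, 0 ≤ t → HasDerivWithinAt y (μ * y t + g t) (Set.Ici t) t)
    (hg : Tendsto g atTop (𝓝 0)) : Tendsto y atTop (𝓝 0) := by
  set a := -μ.re with ha
  have hapos : 0 < a := by linarith
  rw [Metric.tendsto_atTop]
  intro ε hε
  rw [Metric.tendsto_atTop] at hg
  obtain ⟨T₀, hT₀⟩ := hg (ε / 2 * a) (by positivity)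
  set T := max T₀ 0
  have hT : 0 ≤ T := le_max_right _ _
  have hgT : ∀ t, T ≤ t → ‖g t‖ ≤ ε / 2 * a := fun t ht => by
    simpa using (hT₀ t ((le_max_left _ _).trans ht)).le
  set Y : ℝ → ℂ := fun s => Complex.exp (-μ * s) * y s with hY
  have hYc : ContinuousOn Y (Set.Ici 0) := ContinuousOn.mul (by fun_prop) hc
  have key : ∀ t, T ≤ t → ‖Y t‖ ≤ ‖Y T‖ + ε / 2 * (Real.exp (a * t) - Real.exp (a * T)) := by
    intro t ht
    refine image_norm_le_of_norm_deriv_right_le_deriv_boundary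
      (f := Y) (a := T) (b := t) (f' := fun s => Complex.exp (-μ * s) * g s)
      (B := fun s => ‖Y T‖ + ε / 2 * (Real.exp (a * s) - Real.exp (a * T)))
      (B' := fun s => ε / 2 * (Real.exp (a * s) * (a * 1)))
      (hYc.mono fun s hs => hT.trans hs.1)
      (fun s hs => hasDerivWithinAt_cexp_neg_mul (hy s (hT.trans hs.1))) (by simp) ?_ ?_ ⟨ht, le_rfl⟩
    · intro s
      exact ((((hasDerivAt_id s).const_mul a).exp.sub_const _).const_mul _).const_add _
    · intro s hs
      rw [norm_mul, norm_cexp_neg_mul]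
      have := hgT s hs.1
      have h2 := mul_le_mul_of_nonneg_left this (Real.exp_pos (a * s)).le
      linarith
  have hyY : ∀ t, ‖y t‖ = Real.exp (-(a * t)) * ‖Y t‖ := by
    intro t
    rw [hY]
    simp only [norm_mul, norm_cexp_neg_mul]
    rw [← mul_assoc, ← Real.exp_add]
    simp [ha]
  have hlim : Tendsto (fun t : ℝ => Real.exp (-(a * t)) * ‖Y T‖) atTop (𝓝 (0 * ‖Y T‖)) := by
    refine Tendsto.mul_const _ ?_
    exact Real.tendsto_exp_neg_atTop_nhds_zero.comp (tendsto_id.const_mul_atTop hapos)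
  rw [zero_mul, Metric.tendsto_atTop] at hlim
  obtain ⟨T₁, hT₁⟩ := hlim (ε / 2) (by positivity)
  refine ⟨max T T₁, fun t ht => ?_⟩
  have h1 := key t ((le_max_left _ _).trans ht)
  have h3 : Real.exp (-(a * t)) * Real.exp (a * t) = 1 := by rw [← Real.exp_add]; simp
  rw [dist_zero_right, hyY]
  have h4 := mul_le_mul_of_nonneg_left h1 (Real.exp_pos (-(a * t))).le
  have h5 : 0 < Real.exp (-(a * t)) * (ε / 2 * Real.exp (a * T)) := by positivity
  have h6 : Real.exp (-(a * t)) * ‖Y T‖ < ε / 2 := by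
    simpa using hT₁ t ((le_max_right _ _).trans ht)
  nlinarith

/-- If `Re μ ≥ 0` and the input decays exponentially, then a solution of `ẏ = μ y + g` that starts
far enough from `0` stays away from `0`. -/
theorem norm_ge_of_hasDerivWithinAt {y g : ℝ → ℂ} {μ : ℂ} {C α : ℝ} (hμ : 0 ≤ μ.re) (hα : 0 < α)
    (hC : 0 ≤ C)
    (hc : ContinuousOn y (Set.Ici 0))
    (hy : ∀ t, 0 ≤ t → HasDerivWithinAt y (μ * y t + g t) (Set.Ici t) t)
    (hg : ∀ t, 0 ≤ t → ‖g t‖ ≤ C * Real.exp (-α * t)) {t : ℝ} (ht : 0 ≤ t) :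
    ‖y 0‖ - C / α ≤ ‖y t‖ := by
  set Y : ℝ → ℂ := fun s => Complex.exp (-μ * s) * y s with hY
  have hYc : ContinuousOn Y (Set.Ici 0) := ContinuousOn.mul (by fun_prop) hc
  have hle : ∀ s : ℝ, 0 ≤ s → ‖Complex.exp (-μ * s)‖ ≤ 1 := by
    intro s hs
    rw [norm_cexp_neg_mul, Real.exp_le_one_iff]
    nlinarith [mul_nonneg hμ hs]
  have key : ‖Y t - Y 0‖ ≤ C / α * (1 - Real.exp (-α * t)) := by
    refine image_norm_le_of_norm_deriv_right_le_deriv_boundary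
      (f := fun s => Y s - Y 0) (a := 0) (b := t) (f' := fun s => Complex.exp (-μ * s) * g s)
      (B := fun s => C / α * (1 - Real.exp (-α * s)))
      (B' := fun s => C / α * (-(Real.exp (-α * s) * (-α * 1))))
      ((hYc.mono fun s hs => hs.1).sub continuousOn_const)
      (fun s hs => (hasDerivWithinAt_cexp_neg_mul (hy s hs.1)).sub_const _) (by simp) ?_ ?_
      ⟨ht, le_rfl⟩
    · intro s
      exact (((hasDerivAt_id s).const_mul (-α)).exp.const_sub _).const_mul _
    · intro s hs
      rw [norm_mul]
      have h2 := mul_le_mul (hle s hs.1) (hg s hs.1) (norm_nonneg _) zero_le_one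
      have h3 : C / α * (-(Real.exp (-α * s) * (-α * 1))) = C * Real.exp (-α * s) := by
        field_simp
      rw [h3]; linarith
  have h0 : Y 0 = y 0 := by simp [hY]
  rw [h0] at key
  have h1 : ‖Y t‖ ≤ ‖y t‖ := by
    rw [hY]
    simp only [norm_mul]
    exact mul_le_of_le_one_left (norm_nonneg _) (hle t ht)
  have h2 : ‖y 0‖ ≤ ‖Y t‖ + ‖Y t - y 0‖ := by
    have := norm_sub_le (Y t) (Y t - y 0)
    simpa using this
  have h3 : 0 ≤ C / α * Real.exp (-α * t) := by positivity
  linarith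

/-- Variation of constants: the solution of `ż = M z + g` with `z T = v`. -/
theorem exists_hasDerivAt_linear {E : Type*} [NormedAddCommGroup E] [NormedSpace ℝ E]
    [CompleteSpace E] (M : E →L[ℝ] E) {g : ℝ → E} (hg : Continuous g) (T : ℝ) (v : E) :
    ∃ z : ℝ → E, z T = v ∧ ∀ t, HasDerivAt z (M (z t) + g t) t := by
  have hexp : ∀ t : ℝ, HasDerivAt (fun u : ℝ => NormedSpace.exp ((u - T) • M))
      (M * NormedSpace.exp ((t - T) • M)) t := by
    intro t
    have h := (hasDerivAt_exp_smul_const' M (t - T)).scomp t ((hasDerivAt_id t).sub_const T)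
    rw [one_smul] at h
    exact h
  let _ := NormedAlgebra.restrictScalars ℚ ℝ (E →L[ℝ] E)
  have hcont : Continuous fun s : ℝ => NormedSpace.exp (-((s - T) • M)) (g s) := by
    refine Continuous.clm_apply ?_ hg
    exact NormedSpace.exp_continuous.comp (by fun_prop)
  refine ⟨fun t => NormedSpace.exp ((t - T) • M)
    (v + ∫ s in T..t, NormedSpace.exp (-((s - T) • M)) (g s)), by simp, fun t => ?_⟩
  have hint : HasDerivAt (fun t => v + ∫ s in T..t, NormedSpace.exp (-((s - T) • M)) (g s))
      (NormedSpace.exp (-((t - T) • M)) (g t)) t :=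
    (intervalIntegral.integral_hasDerivAt_right (hcont.intervalIntegrable _ _)
      (hcont.stronglyMeasurableAtFilter _ _) hcont.continuousAt).const_add v
  convert (hexp t).clm_apply hint using 1
  congr 1
  have hinv : NormedSpace.exp ((t - T) • M) * NormedSpace.exp (-((t - T) • M)) = 1 := by
    rw [← NormedSpace.exp_add_of_commute (Commute.refl _).neg_right]
    simp
  exact (DFunLike.congr_fun hinv (g t)).symm

/-- A real matrix as a continuous linear map. -/
noncomputable def mulVecCLM {k l : ℕ} (M : Matrix (Fin k) (Fin l) ℝ) :
    (Fin l → ℝ) →L[ℝ] (Fin k → ℝ) :=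
  M.mulVecLin.toContinuousLinearMap

@[simp] theorem mulVecCLM_apply {k l : ℕ} (M : Matrix (Fin k) (Fin l) ℝ) (v : Fin l → ℝ) :
    mulVecCLM M v = M.mulVec v := rfl

theorem norm_le_euclNorm {k : ℕ} (v : Fin k → ℝ) : ‖v‖ ≤ euclNorm v :=
  (pi_norm_le_iff_of_nonneg (norm_nonneg _)).2 fun i =>
    PiLp.norm_apply_le (WithLp.toLp 2 v : EuclideanSpace ℝ (Fin k)) i

theorem exists_euclNorm_le (k : ℕ) : ∃ c : ℝ, 0 < c ∧ ∀ v : Fin k → ℝ, euclNorm v ≤ c * ‖v‖ := by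
  obtain ⟨c, hc, h⟩ := ((EuclideanSpace.equiv (Fin k) ℝ).symm : (Fin k → ℝ) →L[ℝ] EuclideanSpace ℝ (Fin k)).bound
  exact ⟨c, hc, h⟩

theorem continuous_euclNorm {k : ℕ} : Continuous (euclNorm : (Fin k → ℝ) → ℝ) :=
  continuous_norm.comp (PiLp.continuous_toLp 2 _)

theorem euclNorm_zero {k : ℕ} : euclNorm (0 : Fin k → ℝ) = 0 := by simp [euclNorm]

theorem tendsto_euclNorm_zero_iff {k : ℕ} {f : ℝ → Fin k → ℝ} :
    Tendsto (fun t => euclNorm (f t)) atTop (𝓝 0) ↔ Tendsto f atTop (𝓝 0) := by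
  constructor
  · exact fun h => squeeze_zero_norm (fun t => norm_le_euclNorm (f t)) h
  · intro h
    have := (continuous_euclNorm (k := k)).tendsto 0 |>.comp h
    rwa [euclNorm_zero] at this

/-! ### Predictions -/

theorem predicted_self {n : ℕ} (D : DetectorParams n) (s : ℝ) (v : Fin n → ℝ) :
    predicted D s v s = v := by simp [predicted]

attribute [local instance] Matrix.linftyOpNormedRing Matrix.linftyOpNormedAlgebra in
theorem hasDerivAt_predicted {n : ℕ} (D : DetectorParams n) (s : ℝ) (v : Fin n → ℝ) (t : ℝ) :
    HasDerivAt (predicted D s v) (D.Az.mulVec (predicted D s v t)) t := by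
  have h := (hasDerivAt_exp_smul_const' D.Az (t - s)).scomp t ((hasDerivAt_id t).sub_const s)
  rw [one_smul] at h
  let ev : Matrix (Fin n) (Fin n) ℝ →L[ℝ] (Fin n → ℝ) :=
    ((Matrix.mulVecBilin ℝ ℝ).flip v).toContinuousLinearMap
  have := ev.hasFDerivAt.comp_hasDerivAt t h
  rw [predicted, Matrix.mulVec_mulVec]
  exact this

theorem continuous_predicted {n : ℕ} (D : DetectorParams n) (s : ℝ) (v : Fin n → ℝ) :
    Continuous (predicted D s v) :=
  continuous_iff_continuousAt.2 fun t => (hasDerivAt_predicted D s v t).continuousAt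

/-! ### Left eigenvectors and the adjoint of the closed loop -/

theorem mem_spectrum_iff_exists_vecMul {k : ℕ} {M : Matrix (Fin k) (Fin k) ℂ} {μ : ℂ} :
    μ ∈ spectrum ℂ M ↔ ∃ v, v ≠ 0 ∧ Matrix.vecMul v M = μ • v := by
  rw [spectrum.mem_iff, Matrix.isUnit_iff_isUnit_det, isUnit_iff_ne_zero, not_not,
    ← Matrix.exists_vecMul_eq_zero_iff]
  refine exists_congr fun v => and_congr_right fun _ => ?_
  rw [Matrix.vecMul_sub, sub_eq_zero, Algebra.algebraMap_eq_smul_one, Matrix.vecMul_smul,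
    Matrix.vecMul_one, eq_comm]

/-- The adjoint `η ↦ η A - Lᵀ η F` of the operator `z ↦ z Aᵀ - L z Fᵀ`, which is `I ⊗ A - L ⊗ F` when
the state of agent `i` is row `i` of the matrix `z`. -/
noncomputable def adjointDrift {N n : ℕ} (L : Matrix (Fin N) (Fin N) ℂ)
    (A F : Matrix (Fin n) (Fin n) ℂ) : Module.End ℂ (Matrix (Fin N) (Fin n) ℂ) where
  toFun η := η * A - L.transpose * η * F
  map_add' x y := by simp only [Matrix.add_mul, Matrix.mul_add]; abel
  map_smul' c x := by simp [smul_sub]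

/-- Every eigenvalue of `I ⊗ A - L ⊗ F` is an eigenvalue of `A - λ F` for an eigenvalue `λ` of `L`:
the adjoint commutes with `η ↦ Lᵀ η`, so the two have a common eigenvector in each eigenspace. -/
theorem exists_mem_spectrum_of_hasEigenvalue_adjointDrift {N n : ℕ}
    {L : Matrix (Fin N) (Fin N) ℂ} {A F : Matrix (Fin n) (Fin n) ℂ} {μ : ℂ}
    (h : (adjointDrift L A F).HasEigenvalue μ) :
    ∃ lam ∈ spectrum ℂ L, μ ∈ spectrum ℂ (A - lam • F) := by
  let S : Module.End ℂ (Matrix (Fin N) (Fin n) ℂ) :=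
    { toFun := fun η => L.transpose * η
      map_add' := fun x y => Matrix.mul_add _ _ _
      map_smul' := fun c x => by simp }
  have hcomm : ∀ η, adjointDrift L A F (S η) = S (adjointDrift L A F η) := fun η => by
    simp [adjointDrift, S, Matrix.mul_sub, Matrix.mul_assoc]
  let W := (adjointDrift L A F).eigenspace μ
  have hW : ∀ η ∈ W, S η ∈ W := by
    intro η hη
    rw [Module.End.mem_eigenspace_iff] at hη ⊢
    rw [hcomm, hη, map_smul]
  have : Nontrivial W := (Submodule.nontrivial_iff_ne_bot).2 h
  obtain ⟨lam, hlam⟩ := Module.End.exists_eigenvalue (S.restrict hW)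
  obtain ⟨⟨η, hηW⟩, hη⟩ := hlam.exists_hasEigenvector
  have hη0 : η ≠ 0 := fun h0 => hη.2 (Subtype.ext h0)
  have hS : L.transpose * η = lam • η := congrArg Subtype.val hη.apply_eq_smul
  have hΨ : η * A - L.transpose * η * F = μ • η := Module.End.mem_eigenspace_iff.1 hηW
  obtain ⟨i, k, hik⟩ : ∃ i k, η i k ≠ 0 := by
    by_contra! hc
    exact hη0 (Matrix.ext hc)
  refine ⟨lam, mem_spectrum_iff_exists_vecMul.2 ⟨fun j => η j k, fun h0 => hik (congrFun h0 i), ?_⟩,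
    mem_spectrum_iff_exists_vecMul.2 ⟨η i, fun h0 => hik (congrFun h0 k), ?_⟩⟩
  · ext j
    have := congrFun (congrFun hS j) k
    simpa [Matrix.mul_apply, Matrix.vecMul, dotProduct, mul_comm] using this
  · have h1 : η * (A - lam • F) = μ • η := by
      rw [← hΨ, hS, Matrix.mul_sub, Matrix.mul_smul, Matrix.smul_mul]
    ext l
    exact congrFun (congrFun h1 i) l

/-- The real-linear functional `z ↦ ∑ᵢₖ ηᵢₖ zᵢₖ` on the states of all agents. -/
noncomputable def pairing {N n : ℕ} (η : Matrix (Fin N) (Fin n) ℂ) :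
    (Fin N → Fin n → ℝ) →L[ℝ] ℂ :=
  LinearMap.toContinuousLinearMap
    { toFun := fun z => ∑ i, ∑ k, η i k * (z i k : ℂ)
      map_add' := fun x y => by simp [mul_add, Finset.sum_add_distrib]
      map_smul' := fun c x => by
        simp only [Pi.smul_apply, smul_eq_mul, Complex.ofReal_mul, RingHom.id_apply,
          Complex.real_smul, Finset.mul_sum]
        exact Finset.sum_congr rfl fun i _ => Finset.sum_congr rfl fun k _ => by ring }

theorem pairing_apply {N n : ℕ} (η : Matrix (Fin N) (Fin n) ℂ) (z : Fin N → Fin n → ℝ) :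
    pairing η z = ∑ i, ∑ k, η i k * (z i k : ℂ) := rfl

theorem pairing_add_left {N n : ℕ} (η θ : Matrix (Fin N) (Fin n) ℂ) (z : Fin N → Fin n → ℝ) :
    pairing (η + θ) z = pairing η z + pairing θ z := by
  simp [pairing_apply, add_mul, Finset.sum_add_distrib]

theorem pairing_smul_left {N n : ℕ} (c : ℂ) (η : Matrix (Fin N) (Fin n) ℂ)
    (z : Fin N → Fin n → ℝ) : pairing (c • η) z = c * pairing η z := by
  simp [pairing_apply, Finset.mul_sum, mul_assoc]

theorem pairing_eq_trace {N n : ℕ} (η : Matrix (Fin N) (Fin n) ℂ) (z : Fin N → Fin n → ℝ) :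
    pairing η z = (η.transpose * toComplex (Matrix.of z)).trace := by
  rw [pairing_apply, Matrix.trace, Finset.sum_comm]
  simp [Matrix.mul_apply, toComplex]

/-- The linear part `zᵢ ↦ A zᵢ + F ∑_{j ∈ 𝒩ᵢ} (zⱼ - zᵢ)` of the detector equations. -/
noncomputable def drift {N n : ℕ} (G : Digraph (Fin N)) [DecidableRel G.Adj]
    (A F : Matrix (Fin n) (Fin n) ℝ) (z : Fin N → Fin n → ℝ) : Fin N → Fin n → ℝ :=
  fun i => A.mulVec (z i) + F.mulVec (∑ j ∈ inNeighbors G i, (z j - z i))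

theorem sum_inNeighbors_sub {N n : ℕ} (G : Digraph (Fin N)) [DecidableRel G.Adj]
    (z : Fin N → Fin n → ℝ) (i : Fin N) :
    ∑ j ∈ inNeighbors G i, (z j - z i) = fun k => -(laplacian G * Matrix.of z) i k := by
  ext k
  rw [Finset.sum_sub_distrib, Finset.sum_const, laplacian, Matrix.sub_mul, Matrix.sub_apply,
    Matrix.diagonal_mul]
  simp [Matrix.mul_apply, adjacencyMatrix, inNeighbors, Finset.sum_filter]
  exact Finset.sum_congr rfl fun j _ => by split_ifs <;> rfl

theorem drift_eq_mul {N n : ℕ} (G : Digraph (Fin N)) [DecidableRel G.Adj]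
    (A F : Matrix (Fin n) (Fin n) ℝ) (z : Fin N → Fin n → ℝ) :
    Matrix.of (drift G A F z) =
      Matrix.of z * A.transpose - laplacian G * Matrix.of z * F.transpose := by
  ext i k
  rw [Matrix.of_apply, drift, sum_inNeighbors_sub]
  simp [Matrix.mul_apply, Matrix.mulVec, dotProduct, mul_comm, sub_eq_add_neg]

theorem toComplex_mul {k l m : ℕ} (M : Matrix (Fin k) (Fin l) ℝ) (M' : Matrix (Fin l) (Fin m) ℝ) :
    toComplex (M * M') = toComplex M * toComplex M' :=
  Matrix.map_mul (f := Complex.ofRealHom)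

theorem pairing_drift {N n : ℕ} (G : Digraph (Fin N)) [DecidableRel G.Adj]
    (A F : Matrix (Fin n) (Fin n) ℝ) (η : Matrix (Fin N) (Fin n) ℂ) (z : Fin N → Fin n → ℝ) :
    pairing η (drift G A F z) =
      pairing (adjointDrift (toComplex (laplacian G)) (toComplex A) (toComplex F) η) z := by
  have hsub : ∀ M M' : Matrix (Fin N) (Fin n) ℝ,
      toComplex (M - M') = toComplex M - toComplex M' := fun M M' => by ext; simp [toComplex]
  have htr : ∀ M : Matrix (Fin n) (Fin n) ℝ,
      toComplex M.transpose = (toComplex M).transpose := fun M => rfl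
  rw [pairing_eq_trace, pairing_eq_trace, drift_eq_mul, hsub, toComplex_mul, toComplex_mul,
    toComplex_mul, htr, htr]
  simp only [adjointDrift, LinearMap.coe_mk, AddHom.coe_mk, Matrix.transpose_sub,
    Matrix.transpose_mul, Matrix.transpose_transpose, Matrix.mul_sub, Matrix.sub_mul,
    Matrix.trace_sub]
  congr 1
  · rw [← Matrix.mul_assoc, Matrix.trace_mul_comm, Matrix.mul_assoc]
  · rw [← Matrix.mul_assoc, Matrix.trace_mul_comm]
    simp only [Matrix.mul_assoc]

/-! ### Stability of the closed loop with a vanishing input -/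

theorem hasDerivWithinAt_pairing {N n : ℕ} (G : Digraph (Fin N)) [DecidableRel G.Adj]
    {A F : Matrix (Fin n) (Fin n) ℝ} (η : Matrix (Fin N) (Fin n) ℂ)
    {w : ℝ → Fin N → Fin n → ℝ} {f : Fin N → Fin n → ℝ} {t : ℝ}
    (h : HasDerivWithinAt w (drift G A F (w t) + f) (Set.Ici t) t) :
    HasDerivWithinAt (fun s => pairing η (w s))
      (pairing (adjointDrift (toComplex (laplacian G)) (toComplex A) (toComplex F) η) (w t) +
        pairing η f) (Set.Ici t) t := by
  have := (pairing η).hasFDerivAt.comp_hasDerivWithinAt t h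
  rwa [map_add, pairing_drift] at this

/-- If `A - λ F` is Hurwitz for every eigenvalue `λ` of the Laplacian, then solutions of
`ẇ = (I ⊗ A - L ⊗ F) w + f` with `f → 0` tend to zero. Each functional `η` in a generalized
eigenspace of the adjoint satisfies a scalar stable equation whose input tends to zero, by induction
on the order of `η`, and these functionals span. -/
theorem tendsto_zero_of_drift {N n : ℕ} (G : Digraph (Fin N)) [DecidableRel G.Adj]
    {A F : Matrix (Fin n) (Fin n) ℝ}
    (hH : ∀ lam ∈ spectrum ℂ (toComplex (laplacian G)),
      IsHurwitz (toComplex A - lam • toComplex F))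
    {w f : ℝ → Fin N → Fin n → ℝ} (hc : ContinuousOn w (Set.Ici 0))
    (hw : ∀ t, 0 ≤ t → HasDerivWithinAt w (drift G A F (w t) + f t) (Set.Ici t) t)
    (hf : Tendsto f atTop (𝓝 0)) : Tendsto w atTop (𝓝 0) := by
  set Ψ := adjointDrift (toComplex (laplacian G)) (toComplex A) (toComplex F)
  let W : Submodule ℂ (Matrix (Fin N) (Fin n) ℂ) :=
    { carrier := {η | Tendsto (fun t => pairing η (w t)) atTop (𝓝 0)}
      zero_mem' := by simp [pairing_apply]
      add_mem' := fun {a b} ha hb => by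
        simpa [pairing_add_left] using Tendsto.add (show Tendsto _ _ _ from ha) hb
      smul_mem' := fun c x hx => by
        simpa [pairing_smul_left] using Tendsto.const_mul c (show Tendsto _ _ _ from hx) }
  have hk : ∀ μ : ℂ, ∀ k : ℕ, ∀ η, ((Ψ - μ • 1) ^ k) η = 0 → η ∈ W := by
    intro μ k
    induction k with
    | zero =>
      intro η hη
      rw [show η = 0 from hη]
      exact W.zero_mem
    | succ k ih =>
      intro η hη
      have hη' := hη
      rw [pow_succ] at hη
      have hprev : (Ψ - μ • 1) η ∈ W := ih _ hη
      by_cases h0 : η = 0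
      · rw [h0]; exact W.zero_mem
      have hμ : Ψ.HasEigenvalue μ := by
        refine Module.End.hasEigenvalue_of_hasGenEigenvalue (k := k + 1) ?_
        refine fun hbot => h0 ?_
        rw [← Submodule.mem_bot ℂ, ← hbot]
        exact Module.End.mem_genEigenspace_nat.2 hη'
      obtain ⟨lam, hlam, hμs⟩ := exists_mem_spectrum_of_hasEigenvalue_adjointDrift hμ
      refine tendsto_zero_of_hasDerivWithinAt (hH lam hlam μ hμs)
        (g := fun t => pairing ((Ψ - μ • 1) η) (w t) + pairing η (f t))
        ((pairing η).continuous.comp_continuousOn hc) (fun t ht => ?_) ?_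
      · refine (hasDerivWithinAt_pairing G η (hw t ht)).congr_deriv ?_
        rw [← add_assoc, ← pairing_smul_left, ← pairing_add_left]
        simp [Ψ]
      · have h2 : Tendsto (fun t => pairing η (f t)) atTop (𝓝 (pairing η 0)) :=
          ((pairing η).continuous.tendsto 0).comp hf
        rw [map_zero] at h2
        simpa using Tendsto.add (show Tendsto _ _ _ from hprev) h2
  have htop : W = ⊤ := by
    rw [eq_top_iff, ← Module.End.iSup_maxGenEigenspace_eq_top Ψ]
    refine iSup_le fun μ η hη => ?_
    obtain ⟨k, hk'⟩ := Module.End.mem_maxGenEigenspace _ _ _ |>.1 hη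
    exact hk μ k η hk'
  rw [tendsto_pi_nhds]
  intro i
  rw [tendsto_pi_nhds]
  intro k
  have hmem : (Matrix.single i k 1 : Matrix (Fin N) (Fin n) ℂ) ∈ W := htop ▸ Submodule.mem_top
  have hmem' : Tendsto (fun t => pairing (Matrix.single i k 1) (w t)) atTop (𝓝 0) := hmem
  have heq : ∀ z : Fin N → Fin n → ℝ, pairing (Matrix.single i k 1) z = (z i k : ℂ) := by
    intro z
    rw [pairing_apply, Finset.sum_eq_single i, Finset.sum_eq_single k]
    · simp
    · intro b _ hb; simp [Matrix.single, hb.symm]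
    · simp
    · intro b _ hb; simp [Matrix.single, hb.symm]
    · simp
  simp only [heq] at hmem'
  exact (Complex.continuous_re.tendsto 0).comp hmem'

/-! ### Executions before the first accumulation time -/

/-- The right-hand side of the detector equations at observer states `xh`, predictions `p` and
detector states `z`. -/
noncomputable def detectorField {N n : ℕ} (G : Digraph (Fin N)) [DecidableRel G.Adj]
    (D : DetectorParams n) (xh p z : Fin N → Fin n → ℝ) : Fin N → Fin n → ℝ :=
  fun i => D.Az.mulVec (z i) + D.Bz.mulVec (xh i) +
    D.Fz.mulVec (∑ j ∈ inNeighbors G i, (p j - p i))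

theorem exists_norm_detectorField_le {N n : ℕ} (G : Digraph (Fin N)) [DecidableRel G.Adj]
    (D : DetectorParams n) :
    ∃ K : ℝ, 0 < K ∧ ∀ xh p z, ‖detectorField G D xh p z‖ ≤ K * (‖xh‖ + ‖p‖ + ‖z‖) := by
  let Λ : ((Fin N → Fin n → ℝ) × (Fin N → Fin n → ℝ) × (Fin N → Fin n → ℝ)) →ₗ[ℝ]
      (Fin N → Fin n → ℝ) :=
    { toFun := fun q => detectorField G D q.1 q.2.1 q.2.2
      map_add' := fun a b => by
        ext1 i
        simp only [detectorField, Prod.fst_add, Prod.snd_add, Pi.add_apply, Matrix.mulVec_add,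
          add_sub_add_comm, Finset.sum_add_distrib]
        abel
      map_smul' := fun c a => by
        ext1 i
        simp only [detectorField, Prod.smul_fst, Prod.smul_snd, Pi.smul_apply, Matrix.mulVec_smul,
          ← smul_sub, ← Finset.smul_sum, smul_add, RingHom.id_apply] }
  obtain ⟨K, hK, h⟩ := Λ.toContinuousLinearMap.bound
  refine ⟨K, hK, fun xh p z => (h (xh, p, z)).trans (mul_le_mul_of_nonneg_left ?_ hK.le)⟩
  rw [Prod.norm_mk, Prod.norm_mk]
  have h1 := norm_nonneg xh
  have h2 := norm_nonneg p
  have h3 := norm_nonneg z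
  exact max_le (by linarith) (max_le (by linarith) (by linarith))

/-- Prediction errors enter the detector equations as an additional input. -/
theorem detectorField_eq_drift_add {N n : ℕ} (G : Digraph (Fin N)) [DecidableRel G.Adj]
    (D : DetectorParams n) (xh p z : Fin N → Fin n → ℝ) :
    detectorField G D xh p z = drift G D.Az D.Fz z + detectorField G D xh (p - z) 0 := by
  have h : ∀ i, (∑ j ∈ inNeighbors G i, (p j - p i)) = ∑ j ∈ inNeighbors G i, (z j - z i) +
      ∑ j ∈ inNeighbors G i, ((p - z) j - (p - z) i) := fun i => by
    rw [← Finset.sum_add_distrib]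
    exact Finset.sum_congr rfl fun j _ => by simp only [Pi.sub_apply]; abel
  ext1 i
  rw [detectorField, h, Matrix.mulVec_add, Pi.add_apply, drift, detectorField, Pi.zero_apply,
    Matrix.mulVec_zero]
  abel

section Execution

variable {N n m p : ℕ} {G : Digraph (Fin N)} [DecidableRel G.Adj] {S : MASParams n m p}
  {D : DetectorParams n} {x xh : ℝ → Fin N → Fin n → ℝ} {tk : Fin N → ℕ → EReal}
  {z : ℝ → Fin N → Fin n → ℝ}

theorem IsMASSolution.continuousOn_observer (h : IsMASSolution G S x xh) :
    ContinuousOn xh (Set.Ici 0) :=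
  continuousOn_pi.2 fun i t ht => (h.observer t ht i).continuousWithinAt

theorem IsExecution.monotone (h : IsExecution G S D x xh tk z) (i : Fin N) : Monotone (tk i) := by
  refine monotone_nat_of_le_succ fun k => ?_
  rw [h.next_event]
  refine le_sInf ?_
  rintro _ ⟨t, rfl, ht, -⟩
  exact ht.le

theorem IsExecution.nonneg (h : IsExecution G S D x xh tk z) (i : Fin N) (k : ℕ) : 0 ≤ tk i k :=
  h.first_event i ▸ h.monotone i k.zero_le

theorem IsExecution.coe_toReal (h : IsExecution G S D x xh tk z) {i : Fin N} {k : ℕ}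
    (hk : tk i k ≠ ⊤) : ((tk i k).toReal : EReal) = tk i k :=
  EReal.coe_toReal hk (ne_bot_of_le_ne_bot EReal.zero_ne_bot (h.nonneg i k))

theorem IsExecution.continuousOn_Icc (h : IsExecution G S D x xh tk z) {a b : ℝ} (ha : 0 ≤ a)
    (hb : (b : EReal) < lifespan tk) : ContinuousOn z (Set.Icc a b) :=
  continuousOn_pi.2 fun i => (h.continuous i).mono fun _ ht =>
    ⟨ha.trans ht.1, lt_of_le_of_lt (EReal.coe_le_coe_iff.2 ht.2) hb⟩

/-- Before the first accumulation time, the detectors are driven by predictions that differ from the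
true states by at most the threshold. -/
theorem IsExecution.exists_prediction (h : IsExecution G S D x xh tk z) (hcz : 0 < D.cz) {t : ℝ}
    (ht : 0 ≤ t) (htl : (t : EReal) < lifespan tk) :
    ∃ p : Fin N → Fin n → ℝ, ‖p - z t‖ ≤ D.cz * Real.exp (-D.α * t) ∧
      HasDerivWithinAt z (detectorField G D (xh t) p (z t)) (Set.Ici t) t := by
  have hthr : 0 < D.cz * Real.exp (-D.α * t) := by positivity
  have hκ : ∀ j, ∃ k, tk j k ≤ (t : EReal) ∧ (t : EReal) < tk j (k + 1) := by
    intro j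
    have hex : ∃ k, (t : EReal) < tk j k := lt_iSup_iff.1 (htl.trans_le (iInf_le _ j))
    classical
    obtain ⟨k, hk⟩ : ∃ k, Nat.find hex = k + 1 := by
      refine Nat.exists_eq_succ_of_ne_zero fun h0 => ?_
      have := Nat.find_spec hex
      rw [h0, h.first_event] at this
      exact absurd this (not_lt.2 (by exact_mod_cast ht))
    exact ⟨k, not_lt.1 (Nat.find_min hex (hk ▸ k.lt_succ_self)), hk ▸ Nat.find_spec hex⟩
  choose κ hκ using hκ
  refine ⟨fun j => predicted D (tk j (κ j)).toReal (z (tk j (κ j)).toReal j) t, ?_,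
    hasDerivWithinAt_pi.2 (h.detector t ht htl κ hκ)⟩
  refine (pi_norm_le_iff_of_nonneg hthr.le).2 fun j => (norm_le_euclNorm _).trans ?_
  have hcoe := h.coe_toReal (ne_top_of_le_ne_top (EReal.coe_ne_top t) (hκ j).1)
  rcases (hκ j).1.eq_or_lt with heq | hlt
  · have : (tk j (κ j)).toReal = t := by rw [heq, EReal.toReal_coe]
    rw [Pi.sub_apply, this, predicted_self, sub_self, euclNorm_zero]
    exact hthr.le
  · by_contra! hcon
    refine absurd (hκ j).2 (not_lt.2 ?_)
    rw [h.next_event]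
    exact sInf_le ⟨t, rfl, hlt, htl, hcon.le⟩

/-- On a bounded interval without accumulation of events the detector states and their derivatives
are bounded, by Grönwall's inequality. -/
theorem IsExecution.exists_bound (h : IsExecution G S D x xh tk z) (hcz : 0 < D.cz) (hα : 0 < D.α)
    {T : ℝ} (hT : (T : EReal) ≤ lifespan tk) :
    ∃ M : ℝ, 0 ≤ M ∧ ∀ t, 0 ≤ t → t < T → ‖z t‖ ≤ M ∧
      ∃ z', HasDerivWithinAt z z' (Set.Ici t) t ∧ ‖z'‖ ≤ M := by
  obtain ⟨K, hK, hKb⟩ := exists_norm_detectorField_le G D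
  obtain ⟨X, hX⟩ := (isCompact_Icc (a := (0 : ℝ)) (b := T)).exists_bound_of_continuousOn
    (h.mas.continuousOn_observer.mono fun s hs => hs.1)
  have hlt : ∀ {t : ℝ}, t < T → (t : EReal) < lifespan tk := fun ht =>
    (EReal.coe_lt_coe_iff.2 ht).trans_le hT
  have hderiv : ∀ t, 0 ≤ t → t < T → ∃ z', HasDerivWithinAt z z' (Set.Ici t) t ∧
      ‖z'‖ ≤ 2 * K * ‖z t‖ + K * (max X 0 + D.cz) := by
    intro t ht htT
    obtain ⟨p, hp, hz⟩ := h.exists_prediction hcz ht (hlt htT)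
    refine ⟨_, hz, (hKb _ _ _).trans ?_⟩
    have h1 : ‖p‖ ≤ ‖z t‖ + D.cz := by
      have h2 : D.cz * Real.exp (-D.α * t) ≤ D.cz :=
        mul_le_of_le_one_right hcz.le (Real.exp_le_one_iff.2 (by nlinarith))
      calc ‖p‖ = ‖z t + (p - z t)‖ := by rw [add_sub_cancel]
        _ ≤ ‖z t‖ + ‖p - z t‖ := norm_add_le _ _
        _ ≤ _ := by linarith
    have h3 := (hX t ⟨ht, htT.le⟩).trans (le_max_left X 0)
    nlinarith
  choose! z' hz' hz'b using hderiv
  set B := gronwallBound ‖z 0‖ (2 * K) (K * (max X 0 + D.cz)) T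
  have hc : 0 ≤ K * (max X 0 + D.cz) := by positivity
  have hB : ∀ t, 0 ≤ t → t < T → ‖z t‖ ≤ B := by
    intro t ht htT
    refine (norm_le_gronwallBound_of_norm_deriv_right_le (f' := z')
      (h.continuousOn_Icc le_rfl (hlt htT))
      (fun s hs => hz' s hs.1 (hs.2.trans htT)) le_rfl
      (fun s hs => hz'b s hs.1 (hs.2.trans htT)) t ⟨ht, le_rfl⟩).trans ?_
    exact gronwallBound_mono (norm_nonneg _) hc (by positivity) (by linarith)
  refine ⟨max 0 (max B (2 * K * B + K * (max X 0 + D.cz))), le_max_left _ _, fun t ht htT =>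
    ⟨(hB t ht htT).trans ((le_max_left _ _).trans (le_max_right _ _)), z' t, hz' t ht htT,
      (hz'b t ht htT).trans (le_trans ?_ ((le_max_right _ _).trans (le_max_right _ _)))⟩⟩
  have := hB t ht htT
  gcongr

/-- On a bounded interval without accumulation of events, the threshold is not reached within a
fixed time `τ` after an event: the state error vanishes at the event and has a bounded growth rate,
while the threshold is bounded below. -/
theorem IsExecution.exists_gap (h : IsExecution G S D x xh tk z) (hcz : 0 < D.cz) (hα : 0 < D.α)
    {T : ℝ} (hT : (T : EReal) ≤ lifespan tk) :
    ∃ τ : ℝ, 0 < τ ∧ ∀ i k (t : ℝ), tk i k < t → t < T →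
      D.cz * Real.exp (-D.α * t) ≤ euclNorm (stateError D tk z i k t) →
      tk i k + (τ : EReal) ≤ t := by
  obtain ⟨M, hM0, hM⟩ := h.exists_bound hcz hα hT
  obtain ⟨K, hK, hKb⟩ := (mulVecCLM D.Az).bound
  obtain ⟨c, hc, hcb⟩ := exists_euclNorm_le n
  have hthr : 0 < D.cz * Real.exp (-D.α * T) := by positivity
  have hcont : Tendsto (fun s => c * gronwallBound 0 K (K * M + M) s) (𝓝[>] 0) (𝓝 (c * 0)) := by
    have h1 := (hasDerivAt_gronwallBound 0 K (K * M + M) 0).continuousAt.tendsto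
    rw [gronwallBound_x0] at h1
    exact (h1.mono_left nhdsWithin_le_nhds).const_mul c
  rw [mul_zero] at hcont
  obtain ⟨τ, hτlt, hτ⟩ := ((hcont.eventually_lt_const hthr).and self_mem_nhdsWithin).exists
  refine ⟨τ, hτ, fun i k t hkt htT hhit => ?_⟩
  set s := (tk i k).toReal with hs
  have hcoe : (s : EReal) = tk i k := h.coe_toReal (ne_top_of_lt hkt)
  have hs0 : 0 ≤ s := EReal.toReal_nonneg (h.nonneg i k)
  rw [← hcoe] at hkt ⊢
  have hst : s < t := EReal.coe_lt_coe_iff.1 hkt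
  by_contra! hcon
  rw [← EReal.coe_add, EReal.coe_lt_coe_iff] at hcon
  have hM' : ∀ r, s ≤ r → r < t → ‖z r‖ ≤ M ∧
      ∃ z', HasDerivWithinAt z z' (Set.Ici r) r ∧ ‖z'‖ ≤ M := fun r hr hrt =>
    hM r (hs0.trans hr) (hrt.trans htT)
  choose! hzb z' hz' hz'b using hM'
  have hg : ‖stateError D tk z i k t‖ ≤ gronwallBound 0 K (K * M + M) (t - s) := by
    refine norm_le_gronwallBound_of_norm_deriv_right_le (a := s) (b := t)
      (f' := fun r => D.Az.mulVec (predicted D s (z s i) r) - z' r i) ?_ (fun r hr => ?_) ?_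
      (fun r hr => ?_) t ⟨hst.le, le_rfl⟩
    · refine ContinuousOn.sub (continuous_predicted D s _).continuousOn ?_
      exact continuousOn_pi.1 (h.continuousOn_Icc hs0
        ((EReal.coe_lt_coe_iff.2 htT).trans_le hT)) i
    · exact (hasDerivAt_predicted D s (z s i) r).hasDerivWithinAt.sub
        (hasDerivWithinAt_pi.1 (hz' r hr.1 hr.2) i)
    · rw [stateError, ← hs, predicted_self, sub_self, norm_zero]
    · have h1 : D.Az.mulVec (predicted D s (z s i) r) - z' r i =
          D.Az.mulVec (stateError D tk z i k r) + D.Az.mulVec (z r i) - z' r i := by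
        rw [stateError, ← hs, ← Matrix.mulVec_add, sub_add_cancel]
      rw [h1]
      have h2 := hKb (stateError D tk z i k r)
      have h3 := (hKb (z r i)).trans
        (mul_le_mul_of_nonneg_left ((norm_le_pi_norm _ i).trans (hzb r hr.1 hr.2)) hK.le)
      have h4 := (norm_le_pi_norm _ i).trans (hz'b r hr.1 hr.2)
      refine (norm_sub_le _ _).trans ?_
      refine (add_le_add (norm_add_le _ _) h4).trans ?_
      simp only [mulVecCLM_apply] at h2 h3
      linarith
  have h5 : gronwallBound 0 K (K * M + M) (t - s) ≤ gronwallBound 0 K (K * M + M) τ :=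
    gronwallBound_mono le_rfl (by positivity) hK.le (by linarith)
  have h6 : D.cz * Real.exp (-D.α * T) ≤ D.cz * Real.exp (-D.α * t) := by
    refine mul_le_mul_of_nonneg_left (Real.exp_le_exp.2 ?_) hcz.le
    nlinarith
  have h7 := (hcb _).trans (mul_le_mul_of_nonneg_left (hg.trans h5) hc.le)
  linarith

theorem IsExecution.lifespan_eq_top (h : IsExecution G S D x xh tk z) (hcz : 0 < D.cz)
    (hα : 0 < D.α) : lifespan tk = ⊤ := by
  by_contra hne
  have h0 : (0 : EReal) ≤ lifespan tk := le_iInf fun i => (h.nonneg i 0).trans (le_iSup (tk i) 0)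
  have hcoe : ((lifespan tk).toReal : EReal) = lifespan tk :=
    EReal.coe_toReal hne (ne_bot_of_le_ne_bot EReal.zero_ne_bot h0)
  obtain ⟨τ, hτ, hgap⟩ := h.exists_gap hcz hα hcoe.le
  refine hne (iInf_eq_top.2 fun i => ?_)
  have hk : ∀ k : ℕ, ((k * τ : ℝ) : EReal) ≤ tk i k := by
    intro k
    induction k with
    | zero => simpa using h.nonneg i 0
    | succ k ih =>
      rw [h.next_event]
      refine le_sInf ?_
      rintro _ ⟨t, rfl, hkt, htl, hhit⟩
      rw [← hcoe, EReal.coe_lt_coe_iff] at htl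
      refine le_trans ?_ (hgap i k t hkt htl hhit)
      have h1 : ((k + 1 : ℕ) * τ : ℝ) = k * τ + τ := by push_cast; ring
      rw [h1, EReal.coe_add]
      gcongr
  rw [EReal.eq_top_iff_forall_lt]
  intro y
  obtain ⟨k, hk'⟩ := exists_nat_gt (y / τ)
  refine lt_of_lt_of_le ?_ ((hk k).trans (le_iSup (tk i) k))
  rw [EReal.coe_lt_coe_iff]
  rwa [div_lt_iff₀ hτ] at hk'

theorem IsExecution.noZeno (h : IsExecution G S D x xh tk z) (hcz : 0 < D.cz)
    (hα : 0 < D.α) : NoZeno tk := by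
  intro i T
  have htop := iInf_eq_top.1 (h.lifespan_eq_top hcz hα) i
  obtain ⟨k, hk⟩ := lt_iSup_iff.1 (htop.symm ▸ EReal.coe_lt_top T)
  refine (Set.finite_lt_nat k).subset fun l hl => ?_
  by_contra hkl
  exact absurd (hk.trans_le (h.monotone i (not_lt.1 hkl))) (not_lt.2 hl)

theorem IsExecution.exists_interEvent_bound (h : IsExecution G S D x xh tk z) (hcz : 0 < D.cz)
    (hα : 0 < D.α) (T : ℝ) : ∃ τ : ℝ, 0 < τ ∧ ∀ i k, tk i k ≤ (T : EReal) →
      tk i k + (τ : EReal) ≤ tk i (k + 1) := by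
  obtain ⟨τ, hτ, hgap⟩ := h.exists_gap hcz hα (T := T + 1)
    ((h.lifespan_eq_top hcz hα).symm ▸ le_top)
  refine ⟨min τ 1, by positivity, fun i k hk => ?_⟩
  rw [h.next_event]
  refine le_sInf ?_
  rintro _ ⟨t, rfl, hkt, -, hhit⟩
  rcases lt_or_ge t (T + 1) with ht | ht
  · refine le_trans ?_ (hgap i k t hkt ht hhit)
    gcongr
    exact min_le_left _ _
  · refine le_trans (add_le_add hk (EReal.coe_le_coe_iff.2 (min_le_right τ 1))) ?_
    rw [← EReal.coe_add]
    exact EReal.coe_le_coe_iff.2 ht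

end Execution

/-! ### Construction of executions -/

section Existence

variable {N n : ℕ}

/-- The data of an execution up to a time: the current time, the time of the last event of every
agent, the number of its events after time `0`, and the detector states (meaningful up to `time`).
-/
structure RunState (N n : ℕ) where
  time : ℝ
  last : Fin N → ℝ
  count : Fin N → ℕ
  z : ℝ → Fin N → Fin n → ℝ

/-- The state error at time `t` of agent `i` with trajectory `z` relative to a broadcast at time
`s`. -/
noncomputable def errorSince (D : DetectorParams n) (z : ℝ → Fin N → Fin n → ℝ) (i : Fin N)
    (s t : ℝ) : Fin n → ℝ :=
  predicted D s (z s i) t - z t i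

/-- The right-hand side of the detector equations along `z`, if the last broadcasts took place at
the times `last`. -/
noncomputable def fieldSince (G : Digraph (Fin N)) [DecidableRel G.Adj] (D : DetectorParams n)
    (xh z : ℝ → Fin N → Fin n → ℝ) (last : Fin N → ℝ) (t : ℝ) : Fin N → Fin n → ℝ :=
  detectorField G D (xh t) (fun j => predicted D (last j) (z (last j) j) t) (z t)

/-- Up to its current time, a state has no error at the threshold relative to the last events. -/
structure RunState.IsValid (D : DetectorParams n) (σ : RunState N n) : Prop where
  last_le : ∀ i, σ.last i ≤ σ.time
  continuous : Continuous σ.z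
  no_hit : ∀ i t, σ.last i ≤ t → t ≤ σ.time →
    euclNorm (errorSince D σ.z i (σ.last i) t) < D.cz * Real.exp (-D.α * t)

/-- `σ'` continues `σ` up to a later time. No agent reaches its threshold in between, and agents
that have an event at the new time are updated. A step without an event has length at least `1`, so
that steps can be taken forever also if there are no more events. -/
structure RunState.Step (G : Digraph (Fin N)) [DecidableRel G.Adj] (D : DetectorParams n)
    (xh : ℝ → Fin N → Fin n → ℝ) (σ σ' : RunState N n) : Prop where
  time_lt : σ.time < σ'.time
  agree : ∀ t, t ≤ σ.time → σ'.z t = σ.z t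
  deriv : ∀ t, σ.time ≤ t → t < σ'.time →
    HasDerivWithinAt σ'.z (fieldSince G D xh σ'.z σ.last t) (Set.Ici t) t
  no_hit : ∀ i t, σ.last i ≤ t → t < σ'.time →
    euclNorm (errorSince D σ'.z i (σ.last i) t) < D.cz * Real.exp (-D.α * t)
  update : ∀ i, (D.cz * Real.exp (-D.α * σ'.time) ≤
      euclNorm (errorSince D σ'.z i (σ.last i) σ'.time) ∧
      σ'.last i = σ'.time ∧ σ'.count i = σ.count i + 1) ∨
    (σ'.last i = σ.last i ∧ σ'.count i = σ.count i)
  progress : σ.time + 1 ≤ σ'.time ∨ ∃ i, σ'.count i = σ.count i + 1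

theorem continuous_errorSince (D : DetectorParams n) {z : ℝ → Fin N → Fin n → ℝ}
    (hz : Continuous z) (i : Fin N) (s : ℝ) : Continuous (errorSince D z i s) :=
  (continuous_predicted D s _).sub ((continuous_apply i).comp hz)

theorem errorSince_self (D : DetectorParams n) (z : ℝ → Fin N → Fin n → ℝ) (i : Fin N) (s : ℝ) :
    errorSince D z i s s = 0 := by
  rw [errorSince, predicted_self, sub_self]

/-- With the broadcast values kept, the detector equations are linear with a continuous input. -/
theorem RunState.exists_extension (G : Digraph (Fin N)) [DecidableRel G.Adj] (D : DetectorParams n)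
    {xh : ℝ → Fin N → Fin n → ℝ} (hxh : Continuous xh) {σ : RunState N n} (hσ : σ.IsValid D) :
    ∃ z : ℝ → Fin N → Fin n → ℝ, Continuous z ∧ (∀ t, t ≤ σ.time → z t = σ.z t) ∧
      ∀ t, σ.time ≤ t → HasDerivWithinAt z (fieldSince G D xh z σ.last t) (Set.Ici t) t := by
  have hcont : ∀ i, Continuous fun t => D.Bz.mulVec (xh t i) +
      D.Fz.mulVec (∑ j ∈ inNeighbors G i, (predicted D (σ.last j) (σ.z (σ.last j) j) t -
        predicted D (σ.last i) (σ.z (σ.last i) i) t)) := by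
    intro i
    refine Continuous.add ((mulVecCLM D.Bz).continuous.comp ((continuous_apply i).comp hxh))
      ((mulVecCLM D.Fz).continuous.comp (continuous_finsetSum _ fun j _ =>
        (continuous_predicted D _ _).sub (continuous_predicted D _ _)))
  choose w hw0 hw using fun i => exists_hasDerivAt_linear (mulVecCLM D.Az) (hcont i) σ.time
    (σ.z σ.time i)
  have hwc : Continuous fun t i => w i t :=
    continuous_pi fun i => continuous_iff_continuousAt.2 fun t => (hw i t).continuousAt
  have hagree : ∀ t, t ≤ σ.time →
      (if t ≤ σ.time then σ.z t else fun i => w i t) = σ.z t := fun t ht => if_pos ht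
  have hge : ∀ t, σ.time ≤ t →
      (if t ≤ σ.time then σ.z t else fun i => w i t) = fun i => w i t := by
    intro t ht
    split_ifs with h
    · rw [le_antisymm h ht]
      exact funext fun i => (hw0 i).symm
    · rfl
  refine ⟨fun t => if t ≤ σ.time then σ.z t else fun i => w i t, ?_, hagree, fun t ht => ?_⟩
  · refine Continuous.if_le hσ.continuous hwc continuous_id continuous_const fun t ht => ?_
    rw [ht]
    exact funext fun i => (hw0 i).symm
  · have hd : HasDerivWithinAt (fun t i => w i t)
        (fun i => mulVecCLM D.Az (w i t) + (D.Bz.mulVec (xh t i) +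
          D.Fz.mulVec (∑ j ∈ inNeighbors G i, (predicted D (σ.last j) (σ.z (σ.last j) j) t -
            predicted D (σ.last i) (σ.z (σ.last i) i) t)))) (Set.Ici t) t :=
      hasDerivWithinAt_pi.2 fun i => (hw i t).hasDerivWithinAt
    refine (hd.congr (fun s hs => hge s (ht.trans hs)) (hge t ht)).congr_deriv ?_
    ext1 i
    simp only [fieldSince, detectorField, hge t ht, hagree _ (hσ.last_le _), mulVecCLM_apply,
      add_assoc]

theorem RunState.exists_step (G : Digraph (Fin N)) [DecidableRel G.Adj] {D : DetectorParams n}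
    (hcz : 0 < D.cz) {xh : ℝ → Fin N → Fin n → ℝ} (hxh : Continuous xh) {σ : RunState N n}
    (hσ : σ.IsValid D) : ∃ σ' : RunState N n, σ'.IsValid D ∧ σ.Step G D xh σ' := by
  obtain ⟨z, hzc, hagree, hderiv⟩ := RunState.exists_extension G D hxh hσ
  have hthr : ∀ t : ℝ, 0 < D.cz * Real.exp (-D.α * t) := fun t => by positivity
  let err : Fin N → ℝ → ℝ := fun i t => euclNorm (errorSince D z i (σ.last i) t)
  have herrc : ∀ i, Continuous (err i) := fun i =>
    continuous_euclNorm.comp (continuous_errorSince D hzc i _)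
  have hold : ∀ i t, σ.last i ≤ t → t ≤ σ.time → err i t < D.cz * Real.exp (-D.α * t) := by
    intro i t h1 h2
    have := hσ.no_hit i t h1 h2
    simpa only [err, errorSince, hagree _ h2, hagree _ (hσ.last_le i)] using this
  -- The new time is the first time after `σ.time` with an event, or `σ.time + 1` if this is earlier.
  let H : Set ℝ := Set.Icc σ.time (σ.time + 1) ∩
    ({σ.time + 1} ∪ ⋃ i, {t | D.cz * Real.exp (-D.α * t) ≤ err i t})
  have hHcompact : IsCompact H := by
    refine isCompact_Icc.inter_right (isClosed_singleton.union (isClosed_iUnion_of_finite ?_))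
    exact fun i => isClosed_le (by fun_prop) (herrc i)
  obtain ⟨T', ⟨⟨hT'1, hT'2⟩, hT'H⟩, hmin⟩ := hHcompact.exists_isLeast
    ⟨σ.time + 1, ⟨by linarith, le_rfl⟩, Or.inl rfl⟩
  have hlt : σ.time < T' := by
    refine lt_of_le_of_ne hT'1 fun heq => ?_
    rcases hT'H with h | h
    · have : T' = σ.time + 1 := h
      linarith
    · obtain ⟨i, hi⟩ := Set.mem_iUnion.1 h
      have hi' : D.cz * Real.exp (-D.α * T') ≤ err i T' := hi
      rw [← heq] at hi'
      exact absurd (hold i _ (hσ.last_le i) le_rfl) (not_lt.2 hi')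
  have hno : ∀ i t, σ.last i ≤ t → t < T' → err i t < D.cz * Real.exp (-D.α * t) := by
    intro i t h1 h2
    rcases le_total t σ.time with h3 | h3
    · exact hold i t h1 h3
    · by_contra! hcon
      exact absurd (hmin ⟨⟨h3, h2.le.trans hT'2⟩, Or.inr (Set.mem_iUnion.2 ⟨i, hcon⟩)⟩)
        (not_le.2 h2)
  classical
  let hit : Fin N → Prop := fun i => D.cz * Real.exp (-D.α * T') ≤ err i T'
  refine ⟨⟨T', fun i => if hit i then T' else σ.last i,
    fun i => if hit i then σ.count i + 1 else σ.count i, z⟩, ⟨fun i => ?_, hzc,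
      fun i t h1 h2 => ?_⟩, hlt, hagree, fun t h _ => hderiv t h, hno, fun i => ?_, ?_⟩
  · have h1 := hσ.last_le i
    dsimp only
    split_ifs <;> linarith
  · dsimp only at h1 h2 ⊢
    by_cases hi : hit i
    · rw [if_pos hi] at h1 ⊢
      rw [le_antisymm h2 h1, errorSince_self, euclNorm_zero]
      exact hthr _
    · rw [if_neg hi] at h1 ⊢
      rcases h2.lt_or_eq with h | h
      · exact hno i t h1 h
      · rw [h]
        exact not_le.1 hi
  · by_cases hi : hit i
    · exact Or.inl ⟨hi, if_pos hi, if_pos hi⟩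
    · exact Or.inr ⟨if_neg hi, if_neg hi⟩
  · rcases hT'H with h | h
    · exact Or.inl (le_of_eq (show T' = σ.time + 1 from h).symm)
    · obtain ⟨i, hi⟩ := Set.mem_iUnion.1 h
      exact Or.inr ⟨i, if_pos hi⟩

/-- An infinite sequence of steps with a common trajectory `Z`: step `l` ends at time `T (l + 1)`,
and after it the last events are at the times `L (l + 1)`, with `c (l + 1)` events after time
`0`. -/
structure IsRun (G : Digraph (Fin N)) [DecidableRel G.Adj] (D : DetectorParams n)
    (xh : ℝ → Fin N → Fin n → ℝ) (T : ℕ → ℝ) (L : ℕ → Fin N → ℝ) (c : ℕ → Fin N → ℕ)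
    (Z : ℝ → Fin N → Fin n → ℝ) : Prop where
  time_zero : T 0 = 0
  last_zero : ∀ i, L 0 i = 0
  count_zero : ∀ i, c 0 i = 0
  time_lt : ∀ l, T l < T (l + 1)
  last_le : ∀ l i, L l i ≤ T l
  continuousAt : ∀ l t, t < T l → ContinuousAt Z t
  deriv : ∀ l t, T l ≤ t → t < T (l + 1) →
    HasDerivWithinAt Z (fieldSince G D xh Z (L l) t) (Set.Ici t) t
  no_hit : ∀ l i t, L l i ≤ t → t < T (l + 1) →
    euclNorm (errorSince D Z i (L l i) t) < D.cz * Real.exp (-D.α * t)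
  update : ∀ l i, (D.cz * Real.exp (-D.α * T (l + 1)) ≤
      euclNorm (errorSince D Z i (L l i) (T (l + 1))) ∧
      L (l + 1) i = T (l + 1) ∧ c (l + 1) i = c l i + 1) ∨
    (L (l + 1) i = L l i ∧ c (l + 1) i = c l i)
  progress : ∀ l, T l + 1 ≤ T (l + 1) ∨ ∃ i, c (l + 1) i = c l i + 1

theorem exists_isRun (G : Digraph (Fin N)) [DecidableRel G.Adj] {D : DetectorParams n}
    (hcz : 0 < D.cz) {xh : ℝ → Fin N → Fin n → ℝ} (hxh : Continuous xh)
    (z₀ : Fin N → Fin n → ℝ) : ∃ T L c Z, IsRun G D xh T L c Z ∧ Z 0 = z₀ := by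
  have hinit : (⟨0, 0, 0, fun _ => z₀⟩ : RunState N n).IsValid D := by
    refine ⟨fun i => le_rfl, continuous_const, fun i t h1 h2 => ?_⟩
    rw [show t = 0 from le_antisymm h2 h1]
    simp only [Pi.zero_apply]
    rw [errorSince_self, euclNorm_zero]
    positivity
  choose next hvalid hstep using fun σ : {σ : RunState N n // σ.IsValid D} =>
    RunState.exists_step G hcz hxh σ.2
  let σ : ℕ → {σ : RunState N n // σ.IsValid D} :=
    fun l => Nat.rec ⟨_, hinit⟩ (fun _ s => ⟨next s, hvalid s⟩) l
  have hσ : ∀ l, (σ l).1.Step G D xh (σ (l + 1)).1 := fun l => hstep (σ l)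
  have hmono : Monotone fun l => (σ l).1.time := monotone_nat_of_le_succ fun l => (hσ l).time_lt.le
  have hagree : ∀ l l', l ≤ l' → ∀ t, t ≤ (σ l).1.time → (σ l').1.z t = (σ l).1.z t := by
    intro l l' hl
    induction l', hl using Nat.le_induction with
    | base => exact fun _ _ => rfl
    | succ l' hl ih =>
      intro t ht
      rw [(hσ l').agree t (ht.trans (hmono hl)), ih t ht]
  classical
  let Z : ℝ → Fin N → Fin n → ℝ := fun t =>
    if h : ∃ l, t ≤ (σ l).1.time then (σ (Nat.find h)).1.z t else 0
  have hZ : ∀ l t, t ≤ (σ l).1.time → Z t = (σ l).1.z t := by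
    intro l t ht
    have hex : ∃ l, t ≤ (σ l).1.time := ⟨l, ht⟩
    have : Z t = (σ (Nat.find hex)).1.z t := dif_pos hex
    rw [this, hagree _ _ (Nat.find_min' hex ht) _ (Nat.find_spec hex)]
  have hev : ∀ l t, t < (σ l).1.time → Z =ᶠ[𝓝 t] (σ l).1.z := fun l t ht =>
    (eventually_lt_nhds ht).mono fun s hs => hZ l s hs.le
  have hZlast : ∀ l i, Z ((σ l).1.last i) = (σ (l + 1)).1.z ((σ l).1.last i) := fun l i =>
    hZ (l + 1) _ (((σ l).2.last_le i).trans (hσ l).time_lt.le)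
  have herr : ∀ l i t, t ≤ (σ (l + 1)).1.time → errorSince D Z i ((σ l).1.last i) t =
      errorSince D (σ (l + 1)).1.z i ((σ l).1.last i) t := by
    intro l i t ht
    rw [errorSince, errorSince, hZlast l i, hZ (l + 1) t ht]
  refine ⟨fun l => (σ l).1.time, fun l => (σ l).1.last, fun l => (σ l).1.count, Z,
    ⟨rfl, fun i => rfl, fun i => rfl, fun l => (hσ l).time_lt, fun l => (σ l).2.last_le,
      fun l t ht => ?_, fun l t h1 h2 => ?_, fun l i t h1 h2 => ?_, fun l i => ?_,
      fun l => (hσ l).progress⟩, hZ 0 0 le_rfl⟩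
  · exact (σ l).2.continuous.continuousAt.congr (hev l t ht).symm
  · refine (((hσ l).deriv t h1 h2).congr_of_eventuallyEq
      ((hev (l + 1) t h2).filter_mono nhdsWithin_le_nhds) (hZ (l + 1) t h2.le)).congr_deriv ?_
    simp only [fieldSince, hZ (l + 1) t h2.le, hZlast l]
  · rw [herr l i t h2.le]
    exact (hσ l).no_hit i t h1 h2
  · rw [herr l i _ le_rfl]
    exact (hσ l).update i

/-- The event times of the trajectory `Z` before time `E`. -/
noncomputable def eventTimes (D : DetectorParams n) (Z : ℝ → Fin N → Fin n → ℝ) (E : EReal)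
    (i : Fin N) : ℕ → EReal
  | 0 => 0
  | k + 1 => sInf {s : EReal | ∃ t : ℝ, s = (t : EReal) ∧ eventTimes D Z E i k < (t : EReal) ∧
      (t : EReal) < E ∧ D.cz * Real.exp (-D.α * t) ≤
        euclNorm (errorSince D Z i (eventTimes D Z E i k).toReal t)}

theorem monotone_eventTimes (D : DetectorParams n) (Z : ℝ → Fin N → Fin n → ℝ) (E : EReal)
    (i : Fin N) : Monotone (eventTimes D Z E i) := by
  refine monotone_nat_of_le_succ fun k => ?_
  rw [eventTimes]
  refine le_sInf ?_
  rintro _ ⟨t, rfl, ht, -⟩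
  exact ht.le

variable {G : Digraph (Fin N)} [DecidableRel G.Adj] {D : DetectorParams n}
  {xh : ℝ → Fin N → Fin n → ℝ} {T : ℕ → ℝ} {L : ℕ → Fin N → ℝ} {c : ℕ → Fin N → ℕ}
  {Z : ℝ → Fin N → Fin n → ℝ}

theorem IsRun.lt_iSup (h : IsRun G D xh T L c Z) (l : ℕ) :
    (T l : EReal) < ⨆ l, (T l : EReal) :=
  lt_of_lt_of_le (EReal.coe_lt_coe_iff.2 (h.time_lt l)) (le_iSup (fun l => (T l : EReal)) (l + 1))

/-- Relative to the last event of the step, there is no event before the end of the step. -/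
theorem IsRun.le_eventTimes_succ (h : IsRun G D xh T L c Z) {E : EReal} {l k : ℕ} {i : Fin N}
    (hk : eventTimes D Z E i k = L l i) : (T (l + 1) : EReal) ≤ eventTimes D Z E i (k + 1) := by
  rw [eventTimes, hk]
  refine le_sInf ?_
  rintro _ ⟨t, rfl, hlt, -, hhit⟩
  rw [EReal.toReal_coe] at hhit
  by_contra! hcon
  exact absurd (h.no_hit l i t (EReal.coe_lt_coe_iff.1 hlt).le (EReal.coe_lt_coe_iff.1 hcon))
    (not_lt.2 hhit)

theorem IsRun.eventTimes_count (h : IsRun G D xh T L c Z) (l : ℕ) (i : Fin N) :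
    eventTimes D Z (⨆ l, (T l : EReal)) i (c l i) = L l i := by
  induction l with
  | zero => rw [h.count_zero, h.last_zero, eventTimes, EReal.coe_zero]
  | succ l ih =>
    rcases h.update l i with ⟨hhit, hL, hc⟩ | ⟨hL, hc⟩
    · rw [hL, hc]
      refine le_antisymm ?_ (h.le_eventTimes_succ ih)
      rw [eventTimes, ih]
      refine sInf_le ⟨T (l + 1), rfl, ?_, h.lt_iSup _, ?_⟩
      · exact EReal.coe_lt_coe_iff.2 ((h.last_le l i).trans_lt (h.time_lt l))
      · rwa [EReal.toReal_coe]
    · rw [hL, hc, ih]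

/-- Every step has an event or takes unit time. -/
theorem IsRun.le_time_add_sum_count (h : IsRun G D xh T L c Z) (l : ℕ) :
    (l : ℝ) ≤ T l + ∑ i, (c l i : ℝ) := by
  induction l with
  | zero => simp [h.time_zero, h.count_zero]
  | succ l ih =>
    have hle : ∀ i, (c l i : ℝ) ≤ c (l + 1) i := fun i => by
      refine Nat.cast_le.2 ?_
      rcases h.update l i with ⟨-, -, hc⟩ | ⟨-, hc⟩ <;> rw [hc]
      exact Nat.le_succ _
    have hT := h.time_lt l
    push_cast
    rcases h.progress l with h1 | ⟨i, hi⟩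
    · have := Finset.sum_le_sum fun i (_ : i ∈ Finset.univ) => hle i
      linarith
    · have h2 : ∑ j, (c l j : ℝ) + 1 ≤ ∑ j, (c (l + 1) j : ℝ) := by
        rw [← Finset.add_sum_erase _ _ (Finset.mem_univ i),
          ← Finset.add_sum_erase _ (fun j => (c (l + 1) j : ℝ)) (Finset.mem_univ i), hi]
        have := Finset.sum_le_sum fun j (_ : j ∈ Finset.univ.erase i) => hle j
        push_cast
        linarith
      linarith

/-- The lifespan is the limit of the times of the steps. If this limit is finite, some agent has
infinitely many events, since otherwise almost all steps take unit time. -/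
theorem IsRun.lifespan_eq (h : IsRun G D xh T L c Z) :
    lifespan (eventTimes D Z (⨆ l, (T l : EReal))) = ⨆ l, (T l : EReal) := by
  set E := ⨆ l, (T l : EReal) with hE
  refine le_antisymm ?_ (le_iInf fun i => iSup_le fun l => ?_)
  · by_contra! hlt
    have hE0 : (0 : EReal) ≤ E := by
      have := le_iSup (fun l => (T l : EReal)) 0
      rwa [h.time_zero, EReal.coe_zero] at this
    have hcoe : (E.toReal : EReal) = E :=
      EReal.coe_toReal (ne_top_of_lt hlt) (ne_bot_of_le_ne_bot EReal.zero_ne_bot hE0)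
    have hTE : ∀ l, T l ≤ E.toReal := fun l =>
      EReal.coe_le_coe_iff.1 ((le_iSup (fun l => (T l : EReal)) l).trans_eq hcoe.symm)
    have hk : ∀ i, ∃ k, E < eventTimes D Z E i k := fun i =>
      lt_iSup_iff.1 (hlt.trans_le (iInf_le _ i))
    choose k hk using hk
    have hcb : ∀ l i, c l i ≤ k i := by
      intro l i
      by_contra! hcon
      have h1 := (hk i).trans_le (monotone_eventTimes D Z E i hcon.le)
      rw [h.eventTimes_count] at h1
      refine absurd h1 (not_lt.2 (le_trans ?_ (le_iSup (fun l => (T l : EReal)) l)))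
      exact EReal.coe_le_coe_iff.2 (h.last_le l i)
    obtain ⟨l, hl⟩ := exists_nat_gt (E.toReal + ∑ i, (k i : ℝ))
    have h1 := h.le_time_add_sum_count l
    have h2 : ∑ i, (c l i : ℝ) ≤ ∑ i, (k i : ℝ) :=
      Finset.sum_le_sum fun i _ => Nat.cast_le.2 (hcb l i)
    linarith [hTE l]
  · refine le_trans ?_ (le_iSup _ (c l i + 1))
    exact (EReal.coe_le_coe_iff.2 (h.time_lt l).le).trans
      (h.le_eventTimes_succ (h.eventTimes_count l i))

theorem IsRun.isExecution {m p : ℕ} {S : MASParams n m p} {x : ℝ → Fin N → Fin n → ℝ}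
    (h : IsRun G D xh T L c Z) (hmas : IsMASSolution G S x xh) :
    IsExecution G S D x xh (eventTimes D Z (⨆ l, (T l : EReal))) Z := by
  have hlife := h.lifespan_eq
  refine ⟨hmas, fun i => rfl, fun i k => ?_, fun i t ht => ?_, fun t ht0 htl κ hκ => ?_⟩
  · rw [hlife]
    rfl
  · obtain ⟨ht0, ht⟩ := ht
    rw [hlife] at ht
    obtain ⟨l, hl⟩ := lt_iSup_iff.1 ht
    exact ((continuous_apply i).continuousAt.comp
      (h.continuousAt l t (EReal.coe_lt_coe_iff.1 hl))).continuousWithinAt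
  · rw [hlife] at htl
    have hex : ∃ l, t < T l := (lt_iSup_iff.1 htl).imp fun l hl => EReal.coe_lt_coe_iff.1 hl
    classical
    obtain ⟨l, hl⟩ : ∃ l, Nat.find hex = l + 1 := by
      refine Nat.exists_eq_succ_of_ne_zero fun h0 => ?_
      have := Nat.find_spec hex
      rw [h0, h.time_zero] at this
      exact absurd this (not_lt.2 ht0)
    have h1 : T l ≤ t := not_lt.1 (Nat.find_min hex (hl ▸ l.lt_succ_self))
    have h2 : t < T (l + 1) := hl ▸ Nat.find_spec hex
    have hκc : ∀ j, κ j = c l j := by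
      intro j
      have hm := monotone_eventTimes D Z (⨆ l, (T l : EReal)) j
      have hlast : eventTimes D Z (⨆ l, (T l : EReal)) j (c l j) ≤ t := by
        rw [h.eventTimes_count]
        exact EReal.coe_le_coe_iff.2 ((h.last_le l j).trans h1)
      have hnext : (t : EReal) < eventTimes D Z (⨆ l, (T l : EReal)) j (c l j + 1) :=
        (EReal.coe_lt_coe_iff.2 h2).trans_le (h.le_eventTimes_succ (h.eventTimes_count l j))
      rcases lt_trichotomy (κ j) (c l j) with hlt | heq | hgt
      · exact absurd ((hκ j).2.trans_le (hm hlt)) (not_lt.2 hlast)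
      · exact heq
      · exact absurd (hnext.trans_le (hm hgt)) (not_lt.2 (hκ j).1)
    have hL : ∀ j, (eventTimes D Z (⨆ l, (T l : EReal)) j (κ j)).toReal = L l j := fun j => by
      rw [hκc, h.eventTimes_count, EReal.toReal_coe]
    intro i
    simp only [hL]
    exact hasDerivWithinAt_pi.1 (h.deriv l t h1 h2) i

/-- Every solution of the multi-agent system with a continuous extension of the observer states to
the real line drives an execution from every initial detector state. -/
theorem exists_isExecution {m p : ℕ} {S : MASParams n m p} {x : ℝ → Fin N → Fin n → ℝ}
    (hcz : 0 < D.cz) (hmas : IsMASSolution G S x xh) (hxh : Continuous xh)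
    (z₀ : Fin N → Fin n → ℝ) : ∃ tk z, IsExecution G S D x xh tk z ∧ z 0 = z₀ := by
  obtain ⟨T, L, c, Z, h, h0⟩ := exists_isRun G hcz hxh z₀
  exact ⟨_, Z, h.isExecution hmas, h0⟩

/-- The closed loop of agents and observers is a linear equation with constant coefficients. -/
theorem exists_isMASSolution {m p : ℕ} (G : Digraph (Fin N)) [DecidableRel G.Adj]
    (S : MASParams n m p) (x₀ xh₀ : Fin N → Fin n → ℝ) :
    ∃ x xh : ℝ → Fin N → Fin n → ℝ, IsMASSolution G S x xh ∧ Continuous xh ∧ x 0 = x₀ ∧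
      xh 0 = xh₀ := by
  have hu_add : ∀ a b : Fin N → Fin n → ℝ, ∀ i,
      controlInput G S (a + b) i = controlInput G S a i + controlInput G S b i := by
    intro a b i
    simp only [controlInput, Pi.add_apply, add_sub_add_comm, Finset.sum_add_distrib,
      Matrix.mulVec_add, smul_add]
  have hu_smul : ∀ (r : ℝ) (a : Fin N → Fin n → ℝ) i,
      controlInput G S (r • a) i = r • controlInput G S a i := by
    intro r a i
    simp only [controlInput, Pi.smul_apply, ← smul_sub, ← Finset.smul_sum, Matrix.mulVec_smul,
      smul_comm r]
  have hi_add : ∀ a b a' b' : Fin N → Fin n → ℝ, ∀ i,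
      innovation G S (a + b) (a' + b') i = innovation G S a a' i + innovation G S b b' i := by
    intro a b a' b' i
    simp only [innovation, Pi.add_apply, Matrix.mulVec_add, add_sub_add_comm,
      ← Finset.sum_add_distrib]
    exact Finset.sum_congr rfl fun j _ => by abel
  have hi_smul : ∀ (r : ℝ) (a a' : Fin N → Fin n → ℝ) i,
      innovation G S (r • a) (r • a') i = r • innovation G S a a' i := by
    intro r a a' i
    simp only [innovation, Pi.smul_apply, Matrix.mulVec_smul, ← smul_sub, ← smul_add,
      ← Finset.smul_sum]
  let Λ : ((Fin N → Fin n → ℝ) × (Fin N → Fin n → ℝ)) →ₗ[ℝ]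
      ((Fin N → Fin n → ℝ) × (Fin N → Fin n → ℝ)) :=
    { toFun := fun q =>
        (fun i => S.A.mulVec (q.1 i) + S.B.mulVec (controlInput G S q.2 i),
          fun i => S.A.mulVec (q.2 i) + S.B.mulVec (controlInput G S q.2 i)
            + S.c • S.F.mulVec (innovation G S q.1 q.2 i))
      map_add' := fun a b => by
        refine Prod.ext (funext fun i => ?_) (funext fun i => ?_)
        · simp only [Prod.fst_add, Prod.snd_add, Pi.add_apply, hu_add, Matrix.mulVec_add]
          abel
        · simp only [Prod.fst_add, Prod.snd_add, Pi.add_apply, hu_add, hi_add, Matrix.mulVec_add,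
            smul_add]
          abel
      map_smul' := fun r a => by
        refine Prod.ext (funext fun i => ?_) (funext fun i => ?_)
        · simp only [Prod.smul_fst, Prod.smul_snd, Pi.smul_apply, hu_smul, Matrix.mulVec_smul,
            smul_add, RingHom.id_apply]
        · simp only [Prod.smul_fst, Prod.smul_snd, Pi.smul_apply, hu_smul, hi_smul,
            Matrix.mulVec_smul, smul_add, RingHom.id_apply, smul_comm r S.c] }
  obtain ⟨q, hq0, hq⟩ := exists_hasDerivAt_linear Λ.toContinuousLinearMap
    (g := fun _ => 0) continuous_const 0 (x₀, xh₀)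
  simp only [add_zero] at hq
  have h1 : ∀ t, HasDerivAt (fun s => (q s).1) (Λ (q t)).1 t := fun t =>
    ((ContinuousLinearMap.fst ℝ (Fin N → Fin n → ℝ) (Fin N → Fin n → ℝ)).hasFDerivAt
      (x := q t)).comp_hasDerivAt t (hq t)
  have h2 : ∀ t, HasDerivAt (fun s => (q s).2) (Λ (q t)).2 t := fun t =>
    ((ContinuousLinearMap.snd ℝ (Fin N → Fin n → ℝ) (Fin N → Fin n → ℝ)).hasFDerivAt
      (x := q t)).comp_hasDerivAt t (hq t)
  refine ⟨fun t => (q t).1, fun t => (q t).2, ⟨fun t _ i => ?_, fun t _ i => ?_⟩,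
    continuous_iff_continuousAt.2 fun t => (h2 t).continuousAt, by simp [hq0], by simp [hq0]⟩
  · exact (hasDerivAt_pi.1 (h1 t) i).hasDerivWithinAt
  · exact (hasDerivAt_pi.1 (h2 t) i).hasDerivWithinAt

theorem isMASSolution_zero {m p : ℕ} (G : Digraph (Fin N)) [DecidableRel G.Adj]
    (S : MASParams n m p) : IsMASSolution G S 0 0 := by
  constructor <;> intro t _ i
  · simpa [controlInput] using hasDerivWithinAt_const (F := Fin n → ℝ) t (Set.Ici 0) 0
  · simpa [controlInput, innovation] using
      hasDerivWithinAt_const (F := Fin n → ℝ) t (Set.Ici 0) 0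

end Existence

/-! ### The consensus criterion -/

section Consensus

variable {N n m p : ℕ} {G : Digraph (Fin N)} [DecidableRel G.Adj] {S : MASParams n m p}
  {D : DetectorParams n}

theorem IsExecution.continuousOn_Ici {x xh : ℝ → Fin N → Fin n → ℝ} {tk : Fin N → ℕ → EReal}
    {z : ℝ → Fin N → Fin n → ℝ} (h : IsExecution G S D x xh tk z) (hcz : 0 < D.cz)
    (hα : 0 < D.α) : ContinuousOn z (Set.Ici 0) :=
  continuousOn_pi.2 fun i => (h.continuous i).mono fun t ht =>
    ⟨ht, h.lifespan_eq_top hcz hα ▸ EReal.coe_lt_top t⟩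

/-- An execution satisfies the linear detector equations on `[0, ∞)` up to an exponentially decaying
error in the predictions. -/
theorem IsExecution.exists_error {x xh : ℝ → Fin N → Fin n → ℝ} {tk : Fin N → ℕ → EReal}
    {z : ℝ → Fin N → Fin n → ℝ} (h : IsExecution G S D x xh tk z) (hcz : 0 < D.cz)
    (hα : 0 < D.α) : ∃ e : ℝ → Fin N → Fin n → ℝ, ∀ t, 0 ≤ t →
      ‖e t‖ ≤ D.cz * Real.exp (-D.α * t) ∧ HasDerivWithinAt z
        (drift G D.Az D.Fz (z t) + detectorField G D (xh t) (e t) 0) (Set.Ici t) t := by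
  have := fun t (ht : 0 ≤ t) => h.exists_prediction hcz ht
    (h.lifespan_eq_top hcz hα ▸ EReal.coe_lt_top t)
  choose! p hp hz using this
  exact ⟨fun t => p t - z t, fun t ht =>
    ⟨hp t ht, detectorField_eq_drift_add G D _ _ _ ▸ hz t ht⟩⟩

/-- The difference of the detectors and a copy of the single-agent dynamics that is driven by one
observer state satisfies a stable linear equation with a vanishing input. -/
theorem detectorsReachConsensus_of_isHurwitz (hMAS : MASReachesConsensus G S)
    (hAz : IsHurwitz (toComplex D.Az)) (hcz : 0 < D.cz) (hα : 0 < D.α)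
    (hH : ∀ lam ∈ spectrum ℂ (toComplex (laplacian G)), lam ≠ 0 →
      IsHurwitz (toComplex D.Az - lam • toComplex D.Fz)) : DetectorsReachConsensus G S D := by
  intro x xh tk z h r j
  have hH' : ∀ lam ∈ spectrum ℂ (toComplex (laplacian G)),
      IsHurwitz (toComplex D.Az - lam • toComplex D.Fz) := by
    intro lam hlam
    by_cases h0 : lam = 0
    · rwa [h0, zero_smul, sub_zero]
    · exact hH lam hlam h0
  obtain ⟨e, he⟩ := h.exists_error hcz hα
  obtain ⟨K, hK, hKb⟩ := exists_norm_detectorField_le G D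
  -- The observer states are only known to be continuous on `[0, ∞)`, hence the truncation.
  have hgc : Continuous fun t => D.Bz.mulVec (xh (max t 0) r) := by
    refine (mulVecCLM D.Bz).continuous.comp ((continuous_apply r).comp ?_)
    exact h.mas.continuousOn_observer.comp_continuous (by fun_prop) fun t => le_max_right t 0
  obtain ⟨s, -, hs⟩ := exists_hasDerivAt_linear (mulVecCLM D.Az) hgc 0 0
  have hsc : Continuous s := continuous_iff_continuousAt.2 fun t => (hs t).continuousAt
  have hlim : Tendsto (fun t => z t - fun _ => s t) atTop (𝓝 0) := by
    refine tendsto_zero_of_drift G hH'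
      (f := fun t => detectorField G D (xh t - fun _ => xh t r) (e t) 0)
      ((h.continuousOn_Ici hcz hα).sub (by fun_prop)) (fun t ht => ?_) ?_
    · have hs' : HasDerivAt (fun t => (fun _ => s t : Fin N → Fin n → ℝ))
          (fun _ => mulVecCLM D.Az (s t) + D.Bz.mulVec (xh (max t 0) r)) t :=
        hasDerivAt_pi.2 fun _ => hs t
      refine ((he t ht).2.sub hs'.hasDerivWithinAt).congr_deriv ?_
      ext1 i
      simp only [detectorField, drift, Pi.add_apply, Pi.sub_apply, mulVecCLM_apply, max_eq_left ht,
        Matrix.mulVec_sub, sub_sub_sub_cancel_right]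
      abel
    · have h1 : Tendsto (fun t => xh t - fun _ => xh t r) atTop (𝓝 0) :=
        tendsto_pi_nhds.2 fun i => tendsto_euclNorm_zero_iff.1 (hMAS x xh h.mas i r).2
      have h2 : Tendsto (fun t : ℝ => D.cz * Real.exp (-D.α * t)) atTop (𝓝 (D.cz * 0)) := by
        refine Tendsto.const_mul _ (Real.tendsto_exp_atBot.comp ?_)
        exact tendsto_id.const_mul_atTop_of_neg (by linarith)
      have h3 := (h1.norm.add h2).const_mul K
      rw [norm_zero, mul_zero, add_zero, mul_zero] at h3
      refine squeeze_zero_norm' ?_ h3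
      filter_upwards [eventually_ge_atTop 0] with t ht
      refine (hKb _ _ _).trans (mul_le_mul_of_nonneg_left ?_ hK.le)
      rw [norm_zero, add_zero]
      exact add_le_add le_rfl (he t ht).1
  rw [tendsto_euclNorm_zero_iff]
  have := (tendsto_pi_nhds.1 hlim r).sub (tendsto_pi_nhds.1 hlim j)
  simpa using this

/-- Left eigenvectors `ξ` of the Laplacian for `λ ≠ 0` and `θ` of `A - λ F` for `μ` with `Re μ ≥ 0`
give a functional `ξ ⊗ θ` that vanishes at consensus, but is bounded below along an execution with
a large initial state, since it is driven by exponentially decaying prediction errors only. -/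
theorem isHurwitz_of_detectorsReachConsensus (hcz : 0 < D.cz) (hα : 0 < D.α)
    (hcons : DetectorsReachConsensus G S D) {lam : ℂ}
    (hlam : lam ∈ spectrum ℂ (toComplex (laplacian G))) (hlam0 : lam ≠ 0) :
    IsHurwitz (toComplex D.Az - lam • toComplex D.Fz) := by
  intro μ hμ
  by_contra! hre
  obtain ⟨ξ, hξ0, hξ⟩ := mem_spectrum_iff_exists_vecMul.1 hlam
  obtain ⟨θ, hθ0, hθ⟩ := mem_spectrum_iff_exists_vecMul.1 hμ
  obtain ⟨r, hr⟩ := Function.ne_iff.1 hξ0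
  obtain ⟨k, hk⟩ := Function.ne_iff.1 hθ0
  obtain ⟨K, hK, hKb⟩ := exists_norm_detectorField_le G D
  have hξsum : ∑ i, ξ i = 0 := by
    have hrow : ∀ i, ∑ j, toComplex (laplacian G) i j = 0 := fun i => by
      have h0 : ∑ j, laplacian G i j = 0 := by
        simp only [laplacian, Matrix.sub_apply, Finset.sum_sub_distrib, Matrix.diagonal_apply,
          Finset.sum_ite_eq, Finset.mem_univ, if_true, adjacencyMatrix, Matrix.of_apply,
          Finset.sum_boole, inNeighbors, sub_self]
      simp only [toComplex, Matrix.map_apply]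
      rw [← Complex.ofReal_sum, h0, Complex.ofReal_zero]
    have h1 : ∑ j, Matrix.vecMul ξ (toComplex (laplacian G)) j = 0 := by
      simp only [Matrix.vecMul, dotProduct]
      rw [Finset.sum_comm]
      simp only [← Finset.mul_sum, hrow, mul_zero, Finset.sum_const_zero]
    rw [hξ] at h1
    simp only [Pi.smul_apply, smul_eq_mul, ← Finset.mul_sum] at h1
    exact (mul_eq_zero.1 h1).resolve_left hlam0
  set η : Matrix (Fin N) (Fin n) ℂ := Matrix.vecMulVec ξ θ with hη
  have hadj : adjointDrift (toComplex (laplacian G)) (toComplex D.Az) (toComplex D.Fz) η =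
      μ • η := by
    have h1 : adjointDrift (toComplex (laplacian G)) (toComplex D.Az) (toComplex D.Fz) η =
        Matrix.vecMulVec ξ (Matrix.vecMul θ (toComplex D.Az - lam • toComplex D.Fz)) := by
      simp only [adjointDrift, LinearMap.coe_mk, AddHom.coe_mk, hη, Matrix.vecMulVec_mul,
        Matrix.mul_vecMulVec, Matrix.mulVec_transpose, hξ]
      ext i l
      simp only [Matrix.sub_apply, Matrix.vecMulVec_apply, Pi.smul_apply, smul_eq_mul,
        Matrix.vecMul_sub, Matrix.vecMul_smul, Pi.sub_apply]
      ring
    rw [h1, hθ, Matrix.vecMulVec_smul]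
  have hηconst : ∀ v : Fin n → ℝ, pairing η (fun _ => v) = 0 := by
    intro v
    rw [pairing_apply]
    simp only [hη, Matrix.vecMulVec_apply, mul_assoc, ← Finset.mul_sum]
    rw [← Finset.sum_mul, hξsum, zero_mul]
  have hu : pairing η (Pi.single r (Pi.single k 1)) ≠ 0 := by
    rw [pairing_apply, Finset.sum_eq_single r, Finset.sum_eq_single k]
    · simpa [hη, Matrix.vecMulVec_apply] using And.intro hr hk
    · intro b _ hb; simp [hb]
    · simp
    · intro b _ hb; simp [hb]
    · simp
  set u : Fin N → Fin n → ℝ := Pi.single r (Pi.single k 1)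
  set C := ‖pairing η‖ * (K * D.cz)
  have hC : 0 ≤ C := by positivity
  obtain ⟨tk, z, h, hz0⟩ := exists_isExecution (G := G) (D := D) hcz (isMASSolution_zero G S)
    continuous_zero (((C / D.α + 1) / ‖pairing η u‖) • u)
  obtain ⟨e, he⟩ := h.exists_error hcz hα
  have hstart : ‖pairing η (z 0)‖ = C / D.α + 1 := by
    rw [hz0, map_smul, norm_smul, Real.norm_of_nonneg (by positivity),
      div_mul_cancel₀ _ (norm_ne_zero_iff.2 hu)]
  have hlow : ∀ t, 0 ≤ t → 1 ≤ ‖pairing η (z t)‖ := by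
    intro t ht
    have := norm_ge_of_hasDerivWithinAt (y := fun t => pairing η (z t))
      (g := fun t => pairing η (detectorField G D 0 (e t) 0)) (C := C) hre hα hC
      ((pairing η).continuous.comp_continuousOn (h.continuousOn_Ici hcz hα)) (fun s hs => ?_)
      (fun s hs => ?_) ht
    · rw [hstart] at this
      linarith
    · have h1 := hasDerivWithinAt_pairing G η (he s hs).2
      rwa [hadj, pairing_smul_left] at h1
    · have h1 := hKb 0 (e s) 0
      rw [norm_zero, zero_add, add_zero] at h1
      calc ‖pairing η (detectorField G D 0 (e s) 0)‖
          ≤ ‖pairing η‖ * ‖detectorField G D 0 (e s) 0‖ := (pairing η).le_opNorm _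
        _ ≤ ‖pairing η‖ * (K * (D.cz * Real.exp (-D.α * s))) := by
            gcongr
            exact h1.trans (mul_le_mul_of_nonneg_left (he s hs).1 hK.le)
        _ = C * Real.exp (-D.α * s) := by ring
  have hdiff : Tendsto (fun t => z t - fun _ => z t r) atTop (𝓝 0) :=
    tendsto_pi_nhds.2 fun i => tendsto_euclNorm_zero_iff.1 (hcons _ _ _ _ h i r)
  have hlim := (((pairing η).continuous.tendsto 0).comp hdiff).norm
  rw [map_zero, norm_zero] at hlim
  obtain ⟨t, ht, ht0⟩ := ((hlim.eventually_lt_const one_pos).and (eventually_ge_atTop 0)).exists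
  rw [Function.comp_apply, map_sub, hηconst, sub_zero] at ht
  exact absurd (hlow t ht0) (not_le.2 ht)

end Consensus

/-! ### Existence, consensus and absence of Zeno behaviour -/

theorem mainTheorem4 {N n m p : ℕ} (G : Digraph (Fin N)) [DecidableRel G.Adj]
    (hloop : ∀ i, ¬ G.Adj i i) (htree : ContainsSpanningTree G)
    (S : MASParams n m p) (hMAS : MASReachesConsensus G S)
    (D : DetectorParams n) (hdiag : D.Az.IsDiag) (hAz : IsHurwitz (toComplex D.Az))
    (hcz : 0 < D.cz) (hα : 0 < D.α) :
    -- every initial condition has an execution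
    (∀ x₀ xh₀ z₀ : Fin N → Fin n → ℝ, ∃ (x xh : ℝ → Fin N → Fin n → ℝ)
      (tk : Fin N → ℕ → EReal) (z : ℝ → Fin N → Fin n → ℝ),
      IsExecution G S D x xh tk z ∧ x 0 = x₀ ∧ xh 0 = xh₀ ∧ z 0 = z₀) ∧
    -- consensus criterion
    (DetectorsReachConsensus G S D ↔
      ∀ lam ∈ spectrum ℂ (toComplex (laplacian G)), lam ≠ 0 →
        IsHurwitz (toComplex D.Az - lam • toComplex D.Fz)) ∧
    -- no Zeno behaviour; inter-event times are bounded below on every bounded time horizon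
    (∀ (x xh : ℝ → Fin N → Fin n → ℝ) (tk : Fin N → ℕ → EReal) (z : ℝ → Fin N → Fin n → ℝ),
      IsExecution G S D x xh tk z →
        NoZeno tk ∧ lifespan tk = ⊤ ∧
        ∀ T : ℝ, ∃ τ : ℝ, 0 < τ ∧ ∀ i k, tk i k ≤ (T : EReal) →
          tk i k + (τ : EReal) ≤ tk i (k + 1)) := by
  refine ⟨fun x₀ xh₀ z₀ => ?_, ⟨fun hcons lam hlam hlam0 =>
      isHurwitz_of_detectorsReachConsensus hcz hα hcons hlam hlam0,
    detectorsReachConsensus_of_isHurwitz hMAS hAz hcz hα⟩, fun x xh tk z h =>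
    ⟨h.noZeno hcz hα, h.lifespan_eq_top hcz hα, h.exists_interEvent_bound hcz hα⟩⟩
  obtain ⟨x, xh, hmas, hxh, hx0, hxh0⟩ := exists_isMASSolution G S x₀ xh₀
  obtain ⟨tk, z, h, hz0⟩ := exists_isExecution (D := D) hcz hmas hxh z₀
  exact ⟨x, xh, tk, z, h, hx0, hxh0, hz0⟩
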